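/- **Setting.** Let $\omega\in\mathbb{C}$ with $\Im\omega>0$, $\Gamma=\pi\mathbb{Z}+\pi\omega\mathbb{Z}$, and $$\theta(z)=-i\sum_{k\in\mathbb{Z}}(-1)^k e^{i\pi\omega(k+\frac12)^2}e^{2i(k+\frac12)z}.$$ Let $N\ge 0$ be an integer, $\mathsf{x},\mathsf{y}\in\{0,1\}$ with $(\mathsf{x},\mathsf{y})\neq(0,0)$ if $N$ is even, and let $\eta\in\mathbb{C}$ be generic, i.e. $k\eta\notin\Gamma$ for every nonzero integer $k$. Let $\xi_1,\dots,\xi_N\in\mathbb{C}$. Put $$a(\lambda)=\theta(\lambda+\eta),\quad b(\lambda|t)=\frac{\theta(\lambda)\theta(t+\eta)}{\theta(t)},\quad c(\lambda|t)=\frac{\theta(\eta)\theta(t+\lambda)}{\theta(t)},$$ $$R(\lambda|t)=\begin{pmatrix}a(\lambda)&0&0&0\\0&e^{i\mathsf{y}\eta}b(\lambda|t)&e^{i\mathsf{y}\lambda}c(\lambda|t)&0\\0&e^{-i\mathsf{y}\lambda}c(\lambda|-t)&e^{-i\mathsf{y}\eta}b(\lambda|-t)&0\\0&0&0&a(\lambda)\end{pmatrix}\in\mathrm{End}(\mathbb{C}^2\otimes\mathbb{C}^2).$$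 On $V_0\otimes V_1\otimes\cdots\otimes V_N$, $V_n\simeq\mathbb{C}^2$, define the monodromy matrix $$R_{0,N}\big(\lambda-\xi_N\big|t+\eta\textstyle\sum_{a=1}^{N-1}\sigma_a^z\big)\cdots R_{0,1}(\lambda-\xi_1|t)=\begin{pmatrix}\mathsf{A}(\lambda|t)&\mathsf{B}(\lambda|t)\\ \mathsf{C}(\lambda|t)&\mathsf{D}(\lambda|t)\end{pmatrix}_{[0]}.$$ Let $t_0=-\frac\eta2N+\mathsf{x}\frac\pi2+\mathsf{y}\frac\pi2\omega$ and $t(a)=-\eta a+t_0$ for $a\in\mathbb{Z}$. The ket space is $V_1\otimes\cdots\otimes V_N\otimes\mathbb{D}$, where $\mathbb{D}$ has basis $|t(a)\rangle$, $a\in\mathbb{Z}$, with $\tau|t(a)\rangle=t(a)|t(a)\rangle$ and $\mathsf{T}_\tau^{\pm}|t(a)\rangle=|t(a\pm1)\rangle$; the bra space is its restricted dual, spanned by the dual basis of the basis $|h_1\rangle\otimes\cdots\otimes|h_N\rangle\otimes|t(a)\rangle$ (where $h_n\in\{0,1\}$ and $\sigma_n^z|h_n\rangle=(1-2h_n)|h_n\rangle$),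 on which operators act from the right. Set $$\mathcal{C}(\lambda)=\mathsf{C}(\lambda|\tau)\,\mathsf{T}_\tau^+,\qquad \mathcal{D}(\lambda)=\mathsf{D}(\lambda|\tau)\,\mathsf{T}_\tau^-,\qquad \mathsf{S}=\sum_{n=1}^N\sigma_n^z,\qquad \mathsf{S}_\tau=\eta\,\mathsf{S}+2\tau .$$ For $r\in\mathbb{Z}$ let $\bar{\mathbb{D}}^{(r,\mathcal{L})}$ and $\bar{\mathbb{D}}^{(r,\mathcal{R})}$ be the eigenspaces of $\mathsf{S}_\tau$, in the bra space and in the ket space respectively, for the eigenvalue $2r\eta+\mathsf{x}\pi+\mathsf{y}\pi\omega$. For $\mathbf{h}\in\{0,1\}^N$ put $s_{\mathbf h}=\sum_{k}(1-2h_k)$ and $$t_{r,\mathbf{h}}=-\frac\eta2 s_{\mathbf h}+\mathsf{x}\frac\pi2+\mathsf{y}\frac\pi2\omega+r\eta=t\Big(-r-\sum_kh_k\Big),$$ and let $|t_{r,\mathbf h}\rangle$, $\langle t_{r,\mathbf h}|$ be the corresponding basis vector and covector. Let $\mathbf{0}=(0,\dots,0)$, $\mathbf{1}=(1,\dots,1)$,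 $\mathrm{a}(\lambda)=\prod_{n=1}^Na(\lambda-\xi_n)$, $\mathrm{d}(\lambda)=\mathrm{a}(\lambda-\eta)$. For a fixed constant $\nu\in\mathbb{C}\setminus\{0\}$, define $$\langle r,\mathbf{0}|=\frac1{\nu}\,\langle 0|^{\otimes N}\otimes\langle t_{r,\mathbf 0}|,\qquad |\mathbf{1},r\rangle=\frac1{\nu}\,|1\rangle^{\otimes N}\otimes|t_{r,\mathbf 1}\rangle,$$ $$\langle r,\mathbf{h}|=\langle r,\mathbf{0}|\prod_{n=1}^N\Big(\frac{\mathcal{C}(\xi_n)}{\mathrm{d}(\xi_n-\eta)}\Big)^{h_n},\qquad |\mathbf{h},r\rangle=\prod_{n=1}^N\Big(\frac{\mathcal{C}(\xi_n-\eta)}{\mathrm{d}(\xi_n-\eta)}\Big)^{1-h_n}|\mathbf{1},r\rangle ,$$ the products being ordered from left to right for $n=1,\dots,N$. **Theorem.** Assume that $\xi_a-\xi_b+\epsilon\eta\notin\Gamma$ for all $a\neq b$ and all $\epsilon\in\{-1,0,1\}$. Then for every $r\in\mathbb{Z}$ the eigenspaces $\bar{\mathbb{D}}^{(r,\mathcal{L})}$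 and $\bar{\mathbb{D}}^{(r,\mathcal{R})}$ have dimension $2^N$, the states $\langle r,\mathbf{h}|$, $\mathbf{h}\in\{0,1\}^N$, form a basis of $\bar{\mathbb{D}}^{(r,\mathcal{L})}$, and the states $|\mathbf{h},r\rangle$, $\mathbf{h}\in\{0,1\}^N$, form a basis of $\bar{\mathbb{D}}^{(r,\mathcal{R})}$. Moreover, for all $r\in\mathbb{Z}$, $\mathbf{h}\in\{0,1\}^N$ and $\lambda\in\mathbb{C}$, $$\langle r,\mathbf{h}|\,\mathcal{D}(\lambda)=\mathsf{d}_{r-1,\mathbf{h}}(\lambda)\,\langle r-1,\mathbf{h}|,\qquad \mathcal{D}(\lambda)\,|\mathbf{h},r\rangle=\mathsf{d}_{r+1,\mathbf{h}}(\lambda)\,|\mathbf{h},r+1\rangle,$$ where $$\mathsf{d}_{r,\mathbf{h}}(\lambda)=e^{-i\mathsf{y}\eta\frac{s_{\mathbf h}-s_{\mathbf 1}}2}\,\frac{\theta(t_{r,\mathbf{h}})}{\theta(t_{r,\mathbf{1}})}\prod_{n=1}^N\theta(\lambda-\xi_n+\eta h_n).$$ -/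

import Mathlib

noncomputable section

namespace SOS

/-- The theta function `θ₁(z | ω)` with quasi-periods `π` and `π ω` (where `Im ω > 0`). -/
def theta (ω z : ℂ) : ℂ :=
  -Complex.I * ∑' k : ℤ, (-1 : ℂ) ^ k *
    Complex.exp (Complex.I * Real.pi * ω * ((k : ℂ) + 1 / 2) ^ 2) *
    Complex.exp (2 * Complex.I * ((k : ℂ) + 1 / 2) * z)

/-- The lattice `Γ = π ℤ + π ω ℤ`. -/
def lattice (ω : ℂ) : Set ℂ :=
  {z | ∃ m n : ℤ, z = (Real.pi : ℂ) * m + Real.pi * ω * n}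

/-- The numerical parameters of the dynamical 6-vertex model with `N` sites: the modulus `ω`, the
crossing parameter `η`, the integers `x`, `y` and the inhomogeneities `ξ`. -/
structure Params (N : ℕ) where
  ω : ℂ
  η : ℂ
  x : ℕ
  y : ℕ
  ξ : Fin N → ℂ

/-- Spin configurations. At each site, `0` stands for spin `+1` and `1` for spin `-1`. -/
abbrev Spins (N : ℕ) : Type := Fin N → Fin 2

/-- The ket space `(ℂ²)^{⊗ N} ⊗ 𝔻`, written in the dynamical-spin basis
`|h₁⟩ ⊗ ⋯ ⊗ |h_N⟩ ⊗ |t(a)⟩`, which is indexed by `(h, a)`. -/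
abbrev Ket (N : ℕ) : Type := (Spins N × ℤ) →₀ ℂ

/-- Linear forms on the ket space. An operator `X` acts on them from the right, `ψ ↦ ψ ∘ₗ X`. -/
abbrev Bra (N : ℕ) : Type := Module.Dual ℂ (Ket N)

/-- The vector `|h₁⟩ ⊗ ⋯ ⊗ |h_N⟩ ⊗ |t(a)⟩`. -/
def basisKet {N : ℕ} (h : Spins N) (a : ℤ) : Ket N := Finsupp.single (h, a) 1

/-- The dual covector `⟨h₁| ⊗ ⋯ ⊗ ⟨h_N| ⊗ ⟨t(a)|`. -/
def basisBra {N : ℕ} (h : Spins N) (a : ℤ) : Bra N := Finsupp.lapply (h, a)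

/-- The bra space: the restricted dual of the ket space, spanned by the dual basis covectors. -/
def braSpace (N : ℕ) : Submodule ℂ (Bra N) :=
  Submodule.span ℂ (Set.range fun p : Spins N × ℤ => basisBra p.1 p.2)

/-- `s_h = ∑ₖ (1 - 2 hₖ)`. -/
def spinSum {N : ℕ} (h : Spins N) : ℤ := ∑ k, (1 - 2 * ((h k : ℕ) : ℤ))

namespace Params

variable {N : ℕ} (P : Params N)

/-- `θ(z)` for the modulus of the model. -/
def th (z : ℂ) : ℂ := theta P.ω z

def wa (l : ℂ) : ℂ := P.th (l + P.η)

def wb (l t : ℂ) : ℂ := P.th l * P.th (t + P.η) / P.th t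

def wc (l t : ℂ) : ℂ := P.th P.η * P.th (t + l) / P.th t

/-- The dynamical R-matrix `R(l|t)` in the basis `(0,0), (0,1), (1,0), (1,1)` of `V₁ ⊗ V₂`. -/
def R (l t : ℂ) : Matrix (Fin 2 × Fin 2) (Fin 2 × Fin 2) ℂ := fun p q =>
  match p, q with
  | (0, 0), (0, 0) => P.wa l
  | (0, 1), (0, 1) => Complex.exp (Complex.I * P.y * P.η) * P.wb l t
  | (0, 1), (1, 0) => Complex.exp (Complex.I * P.y * l) * P.wc l t
  | (1, 0), (0, 1) => Complex.exp (-(Complex.I * P.y * l)) * P.wc l (-t)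
  | (1, 0), (1, 0) => Complex.exp (-(Complex.I * P.y * P.η)) * P.wb l (-t)
  | (1, 1), (1, 1) => P.wa l
  | _, _ => 0

/-- The operator `R_{0,n}(l - ξ_n | t + η ∑_{a < n} σ_a^z)` on `V₀ ⊗ V₁ ⊗ ⋯ ⊗ V_N`. It does not
change the spins at the sites other than `n`. -/
def siteR (l t : ℂ) (n : Fin N) :
    Matrix (Fin 2 × Spins N) (Fin 2 × Spins N) ℂ := fun p q =>
  if ∀ m, m ≠ n → p.2 m = q.2 m then
    P.R (l - P.ξ n)
      (t + P.η * ∑ a ∈ Finset.univ.filter (fun a => a < n), (1 - 2 * ((q.2 a : ℕ) : ℂ)))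
      (p.1, p.2 n) (q.1, q.2 n)
  else 0

/-- The monodromy matrix `M₀(l|t) = R_{0,N} ⋯ R_{0,1}`. -/
def monodromy (l t : ℂ) : Matrix (Fin 2 × Spins N) (Fin 2 × Spins N) ℂ :=
  (List.ofFn fun n : Fin N => P.siteR l t n).reverse.prod

/-- The entry `(i, j)` of the monodromy matrix with respect to the auxiliary space `V₀`, an operator
on the quantum space: `A = (0,0)`, `B = (0,1)`, `C = (1,0)`, `D = (1,1)`. -/
def monodromyEntry (i j : Fin 2) (l t : ℂ) : Matrix (Spins N) (Spins N) ℂ := fun h h' =>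
  P.monodromy l t (i, h) (j, h')

/-- `t₀ = -(η/2) N + x π/2 + y (π/2) ω`. -/
def t0 : ℂ := -(P.η / 2) * N + P.x * (Real.pi / 2) + P.y * (Real.pi / 2) * P.ω

/-- `t(a) = -η a + t₀`. -/
def tEig (a : ℤ) : ℂ := -P.η * a + P.t0

/-- `t_{r,h} = -(η/2) s_h + x π/2 + y (π/2) ω + r η`. -/
def tVal (r : ℤ) (h : Spins N) : ℂ :=
  -(P.η / 2) * spinSum h + P.x * (Real.pi / 2) + P.y * (Real.pi / 2) * P.ω + r * P.η

/-- The operator `F(τ)` on the ket space, where `F(t)` acts on the quantum space for each `t`: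
`|h⟩ ⊗ |t(a)⟩ ↦ F(t(a))|h⟩ ⊗ |t(a)⟩`. -/
def atTau (F : ℂ → Matrix (Spins N) (Spins N) ℂ) : Module.End ℂ (Ket N) :=
  Finsupp.linearCombination ℂ fun p : Spins N × ℤ =>
    ∑ h : Spins N, F (P.tEig p.2) h p.1 • basisKet h p.2

/-- The dynamical operator `τ`, with `τ |t(a)⟩ = t(a) |t(a)⟩`. -/
def tau : Module.End ℂ (Ket N) :=
  Finsupp.linearCombination ℂ fun p : Spins N × ℤ => P.tEig p.2 • basisKet p.1 p.2

end Params

/-- The operator `|h⟩ ⊗ |t(a)⟩ ↦ |h⟩ ⊗ |t(a + k)⟩`. The operators `T_τ^{±}` are obtained for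
`k = ±1`. -/
def shiftOp (N : ℕ) (k : ℤ) : Module.End ℂ (Ket N) :=
  Finsupp.linearCombination ℂ fun p : Spins N × ℤ => basisKet p.1 (p.2 + k)

/-- The total spin operator `S = ∑ₙ σ_n^z`. -/
def spinOp (N : ℕ) : Module.End ℂ (Ket N) :=
  Finsupp.linearCombination ℂ fun p : Spins N × ℤ => (spinSum p.1 : ℂ) • basisKet p.1 p.2

namespace Params

variable {N : ℕ} (P : Params N)

/-- `𝒞(l) = C(l|τ) T_τ^+`. -/
def opC (l : ℂ) : Module.End ℂ (Ket N) :=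
  P.atTau (P.monodromyEntry 1 0 l) * shiftOp N 1

/-- `𝒟(l) = D(l|τ) T_τ^-`. -/
def opD (l : ℂ) : Module.End ℂ (Ket N) :=
  P.atTau (P.monodromyEntry 1 1 l) * shiftOp N (-1)

/-- `S_τ = η S + 2 τ`. -/
def Stau : Module.End ℂ (Ket N) := P.η • spinOp N + (2 : ℂ) • P.tau

/-- The eigenvalue `2 r η + x π + y π ω` of `S_τ`. -/
def StauEig (r : ℤ) : ℂ := 2 * r * P.η + P.x * Real.pi + P.y * Real.pi * P.ω

/-- The eigenspace of `S_τ` in the ket space. -/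
def ketEigenspace (r : ℤ) : Submodule ℂ (Ket N) :=
  Module.End.eigenspace P.Stau (P.StauEig r)

/-- The eigenspace of `S_τ`, acting by `ψ ↦ ψ ∘ₗ S_τ`, in the bra space. -/
def braEigenspace (r : ℤ) : Submodule ℂ (Bra N) :=
  braSpace N ⊓ Module.End.eigenspace (LinearMap.dualMap P.Stau) (P.StauEig r)

/-- `a(l) = ∏ₙ θ(l - ξ_n + η)`. -/
def fa (l : ℂ) : ℂ := ∏ n, P.wa (l - P.ξ n)

/-- `d(l) = a(l - η)`. -/
def fd (l : ℂ) : ℂ := P.fa (l - P.η)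

/-- The integer `a` with `t(a) = t_{r,h}`. -/
def tIndex (r : ℤ) (h : Spins N) : ℤ := -r - ∑ k, ((h k : ℕ) : ℤ)

theorem tEig_tIndex (r : ℤ) (h : Spins N) : P.tEig (tIndex r h) = P.tVal r h := by
  simp only [tEig, tIndex, t0, tVal, spinSum, Finset.sum_sub_distrib, ← Finset.mul_sum]
  simp
  ring

/-- The left reference state `⟨r,𝟎|`, with normalization constant `c`. -/
def braRef (N : ℕ) (c : ℂ) (r : ℤ) : Bra N :=
  c⁻¹ • basisBra (fun _ => 0) (tIndex r fun _ : Fin N => 0)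

/-- The right reference state `|𝟏,r⟩`, with normalization constant `c`. -/
def ketRef (N : ℕ) (c : ℂ) (r : ℤ) : Ket N :=
  c⁻¹ • basisKet (fun _ => 1) (tIndex r fun _ : Fin N => 1)

/-- The state `⟨r,h| = ⟨r,𝟎| ∏ₙ (𝒞(ξ_n) / d(ξ_n - η))^{h_n}`, the product being taken from left to
right for `n = 1, …, N`. -/
def bra (c : ℂ) (r : ℤ) (h : Spins N) : Bra N :=
  braRef N c r ∘ₗ (List.ofFn fun n : Fin N =>
    ((P.fd (P.ξ n - P.η))⁻¹ • P.opC (P.ξ n)) ^ (h n : ℕ)).prod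

/-- The state `|h,r⟩ = ∏ₙ (𝒞(ξ_n - η) / d(ξ_n - η))^{1 - h_n} |𝟏,r⟩`, the product being taken from
left to right for `n = 1, …, N`. -/
def ket (c : ℂ) (r : ℤ) (h : Spins N) : Ket N :=
  (List.ofFn fun n : Fin N =>
    ((P.fd (P.ξ n - P.η))⁻¹ • P.opC (P.ξ n - P.η)) ^ (1 - (h n : ℕ))).prod (ketRef N c r)

/-- `d_{r,h}(l) = e^{-i y η (s_h - s_𝟏)/2} (θ(t_{r,h}) / θ(t_{r,𝟏})) ∏ₙ θ(l - ξ_n + η h_n)`. -/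
def dCoeff (r : ℤ) (h : Spins N) (l : ℂ) : ℂ :=
  Complex.exp (-(Complex.I * P.y * P.η *
      (((spinSum h : ℂ) - (spinSum (fun _ : Fin N => (1 : Fin 2)) : ℂ)) / 2))) *
    (P.th (P.tVal r h) / P.th (P.tVal r fun _ => 1)) *
    ∏ n, P.th (l - (P.ξ n - P.η * ((h n : ℕ) : ℂ)))

end Params

end SOS

end

/-! The states are built for separation of variables: commuting operators `𝒞` create them, and
`𝒟(l)` is diagonal on them up to a shift of `r`. Two facts about θ carry the argument: Weierstrass'
three-term identity (`theta_three_term`), and the inclusion of its zeros in Γ (`theta_eq_zero`). The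
first gives the dynamical Yang-Baxter equation and then, by induction on the number of sites, the
exchange relations of C and D (`rtt_row`). The second turns genericity into the nonvanishing of all
denominators.

The action of `𝒟` follows by adding one factor `𝒞` at a time. Exchanging `𝒟(l)` with `𝒞(ξ_n)`
produces a direct term and an unwanted term containing `𝒟(ξ_n)`. On a bra with `h_n = 0` the
unwanted term carries the factor θ(0) and disappears, while the direct term changes the coefficient
exactly from that of `h` to that of the flipped configuration. Kets are treated alike, with `ξ_n -
η` and `h_n = 1`.

For linear independence (`linearIndependent_of_ladder`), the product of the `𝒟(ξ_n - η(1 - h_n))`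
kills every state except the one labelled `h`. The states are nonzero because the one with all
factors `𝒞` applied is a nonzero multiple of a single basis vector, found by moving a domain wall
through the chain. Finally `S_τ` is diagonal and fixes `a` once the spins are given, so each
eigenspace lies in the span of `2^N` vectors, and counting dimensions finishes the proof. -/

noncomputable section

open Complex
open scoped Real

namespace SOS

/-! ### Jacobi theta series: nontriviality and a product formula. -/

section JacobiTheta

variable {τ : ℂ}

/-- On the real line this is a uniformly convergent Fourier series with constant coefficient 1, so
integrating an identically zero sum over [0, 1] would give 1 = 0. -/
theorem jacobiTheta₂_not_forall_eq_zero (hτ : 0 < τ.im) : ∃ z, jacobiTheta₂ z τ ≠ 0 := by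
  by_contra! h0
  let f : ℤ → C(ℝ, ℂ) := fun n =>
    ⟨fun x => jacobiTheta₂_term n x τ, by unfold jacobiTheta₂_term; fun_prop⟩
  have hnorm : ∀ n (x : ℝ), ‖jacobiTheta₂_term n x τ‖ = ‖jacobiTheta₂_term n 0 τ‖ := by
    intro n x
    simp [norm_jacobiTheta₂_term]
  have hs : Summable fun n : ℤ =>
      ‖(f n).restrict (⟨Set.uIcc 0 1, isCompact_uIcc⟩ : TopologicalSpace.Compacts ℝ)‖ := by
    refine Summable.of_nonneg_of_le (fun _ => norm_nonneg _) (fun n => ?_)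
      ((summable_jacobiTheta₂_term_iff 0 τ).2 hτ).norm
    refine (ContinuousMap.norm_le _ (norm_nonneg _)).2 fun x => ?_
    exact (hnorm n x).le
  have key := intervalIntegral.hasSum_intervalIntegral_of_summable_norm (a := 0) (b := 1) hs
  have hz : ∀ x : ℝ, ∑' n, f n x = 0 := fun x => h0 x
  simp only [hz, intervalIntegral.integral_zero] at key
  have hint : ∀ n : ℤ, n ≠ 0 → ∫ x in (0 : ℝ)..1, f n x = 0 := by
    intro n hn
    have hc : 2 * π * I * n ≠ 0 := by
      simp [hn, Real.pi_ne_zero]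
    have : ∀ x : ℝ, f n x = cexp (2 * π * I * n * x) * cexp (π * I * n ^ 2 * τ) := by
      intro x
      simp [f, jacobiTheta₂_term, Complex.exp_add]
    simp_rw [this]
    rw [intervalIntegral.integral_mul_const, integral_exp_mul_complex hc]
    have h1 : cexp (2 * π * I * n * (1 : ℝ)) = 1 := by
      rw [Complex.exp_eq_one_iff]
      exact ⟨n, by push_cast; ring⟩
    rw [h1]
    simp
  have h1 := hasSum_single (f := fun n => ∫ x in (0 : ℝ)..1, f n x) 0 hint
  have := key.unique h1
  simp [f, jacobiTheta₂_term] at this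

/-- `ℤ × ℤ` split according to the parity of the sum of the two coordinates. -/
def intPairParity : (ℤ × ℤ) ⊕ (ℤ × ℤ) → ℤ × ℤ :=
  Sum.elim (fun p => (p.1 + p.2, p.1 - p.2)) (fun p => (p.1 + p.2 + 1, p.1 - p.2))

theorem intPairParity_bijective : Function.Bijective intPairParity := by
  constructor
  · rintro (⟨a, b⟩ | ⟨a, b⟩) (⟨a', b'⟩ | ⟨a', b'⟩) h <;>
      simp only [intPairParity, Sum.elim_inl, Sum.elim_inr, Prod.mk.injEq] at h <;>
      obtain ⟨h1, h2⟩ := h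
    · have : a = a' := by omega
      have : b = b' := by omega
      simp [*]
    · omega
    · omega
    · have : a = a' := by omega
      have : b = b' := by omega
      simp [*]
  · rintro ⟨m, n⟩
    rcases Int.even_or_odd' (m + n) with ⟨k, hk | hk⟩
    · exact ⟨Sum.inl (k, m - k), Prod.ext (by simp [intPairParity])
        (by simp only [intPairParity, Sum.elim_inl]; omega)⟩
    · exact ⟨Sum.inr (k, m - k - 1), Prod.ext (by simp only [intPairParity, Sum.elim_inr]; omega)
        (by simp only [intPairParity, Sum.elim_inr]; omega)⟩

theorem hasSum_jacobiTheta₂_mul (hτ : 0 < τ.im) (z w : ℂ) :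
    HasSum (fun p : ℤ × ℤ => jacobiTheta₂_term p.1 z τ * jacobiTheta₂_term p.2 w τ)
      (jacobiTheta₂ z τ * jacobiTheta₂ w τ) := by
  have hs : ∀ u : ℂ, Summable fun n => ‖jacobiTheta₂_term n u τ‖ :=
    fun u => ((summable_jacobiTheta₂_term_iff u _).2 hτ).norm
  have h := HasSum.mul (f := fun n => jacobiTheta₂_term n z τ)
    (g := fun n => jacobiTheta₂_term n w τ)
    (hasSum_jacobiTheta₂_term z hτ) (hasSum_jacobiTheta₂_term w hτ)
    (summable_mul_of_summable_norm (f := fun n => jacobiTheta₂_term n z τ)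
      (g := fun n => jacobiTheta₂_term n w τ) (hs z) (hs w))
  exact h

/-- The change of indices by parity turns `m² + n²` into `2a² + 2b²` plus, in the odd class, linear
terms. The double series therefore factors at modulus `2τ`, and the linear terms become translations
by `τ`. -/
theorem jacobiTheta₂_mul (hτ : 0 < τ.im) (z w : ℂ) :
    jacobiTheta₂ z τ * jacobiTheta₂ w τ =
      jacobiTheta₂ (z + w) (2 * τ) * jacobiTheta₂ (z - w) (2 * τ) +
      cexp (2 * π * I * z + π * I * τ) *
        (jacobiTheta₂ (z + w + τ) (2 * τ) * jacobiTheta₂ (z - w + τ) (2 * τ)) := by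
  have h2τ : 0 < (2 * τ).im := by simpa using hτ
  have h1 := hasSum_jacobiTheta₂_mul h2τ (z + w) (z - w)
  have h2 := (hasSum_jacobiTheta₂_mul h2τ (z + w + τ) (z - w + τ)).mul_left
    (cexp (2 * π * I * z + π * I * τ))
  have hT := (Equiv.ofBijective _ intPairParity_bijective).hasSum_iff.2
    (hasSum_jacobiTheta₂_mul hτ z w)
  refine hT.unique (HasSum.sum ?_ ?_)
  · refine Eq.mpr (congrArg (fun f => HasSum f _) (funext fun p => ?_)) h1
    change jacobiTheta₂_term (intPairParity (.inl p)).1 z τ *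
      jacobiTheta₂_term (intPairParity (.inl p)).2 w τ = _
    simp only [intPairParity, Sum.elim_inl, jacobiTheta₂_term, ← Complex.exp_add]
    push_cast
    ring_nf
  · refine Eq.mpr (congrArg (fun f => HasSum f _) (funext fun p => ?_)) h2
    change jacobiTheta₂_term (intPairParity (.inr p)).1 z τ *
      jacobiTheta₂_term (intPairParity (.inr p)).2 w τ = _
    simp only [intPairParity, Sum.elim_inr, jacobiTheta₂_term, ← Complex.exp_add]
    push_cast
    ring_nf

end JacobiTheta

/-! ### The function θ: quasi-periods, three-term identity, zeros. -/

section Theta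

variable {ω : ℂ}

theorem theta_eq_jacobiTheta₂ (ω z : ℂ) :
    theta ω z = -I * cexp (I * π * ω / 4 + I * z) * jacobiTheta₂ (z / π + ω / 2 + 1 / 2) ω := by
  unfold theta jacobiTheta₂
  rw [← tsum_mul_left, ← tsum_mul_left]
  refine tsum_congr fun k => ?_
  have h : (-1 : ℂ) ^ k = cexp (I * π * k) := by
    rw [mul_comm I, mul_comm _ (k : ℂ), Complex.exp_int_mul, Complex.exp_pi_mul_I]
  have hp : (π : ℂ) ≠ 0 := by exact_mod_cast Real.pi_ne_zero
  rw [h, jacobiTheta₂_term, mul_assoc (-I), ← Complex.exp_add, ← Complex.exp_add,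
    ← Complex.exp_add]
  congr 2
  field_simp
  ring

theorem theta_add_pi (ω z : ℂ) : theta ω (z + π) = -theta ω z := by
  have hp : (π : ℂ) ≠ 0 := by exact_mod_cast Real.pi_ne_zero
  rw [theta_eq_jacobiTheta₂, theta_eq_jacobiTheta₂,
    show (z + π) / π + ω / 2 + 1 / 2 = z / π + ω / 2 + 1 / 2 + 1 by field_simp; ring,
    jacobiTheta₂_add_left,
    show I * π * ω / 4 + I * (z + π) = (I * π * ω / 4 + I * z) + π * I by ring,
    Complex.exp_add _ (π * I), Complex.exp_pi_mul_I]
  ring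

theorem theta_add_pi_mul (ω z : ℂ) :
    theta ω (z + π * ω) = -cexp (-(I * π * ω) - 2 * I * z) * theta ω z := by
  have hp : (π : ℂ) ≠ 0 := by exact_mod_cast Real.pi_ne_zero
  rw [theta_eq_jacobiTheta₂, theta_eq_jacobiTheta₂,
    show (z + π * ω) / π + ω / 2 + 1 / 2 = z / π + ω / 2 + 1 / 2 + ω by field_simp; ring,
    jacobiTheta₂_add_left']
  have h : cexp (I * π * ω / 4 + I * (z + π * ω)) *
      cexp (-π * I * (ω + 2 * (z / π + ω / 2 + 1 / 2))) =
      -(cexp (-(I * π * ω) - 2 * I * z) * cexp (I * π * ω / 4 + I * z)) := by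
    rw [← Complex.exp_add, ← Complex.exp_add, ← Complex.exp_sub_pi_mul_I]
    congr 1
    field_simp
    ring
  linear_combination (-I * jacobiTheta₂ (z / π + ω / 2 + 1 / 2) ω) * h

theorem theta_neg (ω z : ℂ) : theta ω (-z) = -theta ω z := by
  have hp : (π : ℂ) ≠ 0 := by exact_mod_cast Real.pi_ne_zero
  rw [theta_eq_jacobiTheta₂, theta_eq_jacobiTheta₂, ← jacobiTheta₂_neg_left,
    show -(-z / π + ω / 2 + 1 / 2) = z / π - ω / 2 - 1 / 2 by ring,
    show z / π + ω / 2 + 1 / 2 = z / π - ω / 2 - 1 / 2 + 1 + ω by ring,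
    jacobiTheta₂_add_left', jacobiTheta₂_add_left]
  have h : cexp (I * π * ω / 4 + I * z) *
      cexp (-π * I * (ω + 2 * (z / π - ω / 2 - 1 / 2 + 1))) =
      -cexp (I * π * ω / 4 + I * -z) := by
    rw [← Complex.exp_add, ← Complex.exp_sub_pi_mul_I]
    congr 1
    field_simp
    ring
  linear_combination (-I * jacobiTheta₂ (z / π - ω / 2 - 1 / 2) ω) * h

theorem theta_zero (ω : ℂ) : theta ω 0 = 0 := by
  have := theta_neg ω 0
  rw [neg_zero] at this
  linear_combination this / 2

theorem differentiable_theta (hω : 0 < ω.im) : Differentiable ℂ (theta ω) := by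
  have : theta ω = fun z =>
      -I * cexp (I * π * ω / 4 + I * z) * jacobiTheta₂ (z / π + ω / 2 + 1 / 2) ω :=
    funext (theta_eq_jacobiTheta₂ ω)
  rw [this]
  intro z
  refine DifferentiableAt.mul (by fun_prop) ?_
  exact (differentiableAt_jacobiTheta₂_fst _ hω).comp z
    (f := fun z : ℂ => z / π + ω / 2 + 1 / 2) (by fun_prop)

theorem theta_not_forall_eq_zero (hω : 0 < ω.im) : ∃ z, theta ω z ≠ 0 := by
  obtain ⟨z, hz⟩ := jacobiTheta₂_not_forall_eq_zero hω
  have hp : (π : ℂ) ≠ 0 := by exact_mod_cast Real.pi_ne_zero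
  refine ⟨π * (z - ω / 2 - 1 / 2), ?_⟩
  rw [theta_eq_jacobiTheta₂, show π * (z - ω / 2 - 1 / 2) / π + ω / 2 + 1 / 2 = z by
    field_simp; ring]
  exact mul_ne_zero (mul_ne_zero (neg_ne_zero.2 I_ne_zero) (Complex.exp_ne_zero _)) hz

/-- The products `θ(x + y) θ(x - y)` are the `2 × 2` minors of a two-component theta vector. -/
theorem exists_theta_add_mul_theta_sub (hω : 0 < ω.im) :
    ∃ F G : ℂ → ℂ, ∀ x y, theta ω (x + y) * theta ω (x - y) = F x * G y - G x * F y := by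
  have hp : (π : ℂ) ≠ 0 := by exact_mod_cast Real.pi_ne_zero
  -- The two components are the theta series at modulus `2ω` of the even and odd parity classes.
  refine ⟨fun x => jacobiTheta₂ (2 * x / π) (2 * ω),
    fun x => cexp (2 * I * x + I * π * ω / 2) * jacobiTheta₂ (2 * x / π + ω) (2 * ω), ?_⟩
  intro x y
  simp only []
  have hmul := jacobiTheta₂_mul hω ((x + y) / π + ω / 2 + 1 / 2) ((x - y) / π + ω / 2 + 1 / 2)
  rw [show (x + y) / π + ω / 2 + 1 / 2 + ((x - y) / π + ω / 2 + 1 / 2) = 2 * x / π + ω + 1 by ring,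
    show (x + y) / π + ω / 2 + 1 / 2 - ((x - y) / π + ω / 2 + 1 / 2) = 2 * y / π by ring,
    jacobiTheta₂_add_left, show 2 * x / π + ω + 1 + ω = 2 * x / π + 1 + 2 * ω by ring,
    jacobiTheta₂_add_left', jacobiTheta₂_add_left] at hmul
  rw [theta_eq_jacobiTheta₂, theta_eq_jacobiTheta₂]
  have h1 : cexp (I * π * ω / 4 + I * (x + y)) * cexp (I * π * ω / 4 + I * (x - y)) =
      cexp (2 * I * x + I * π * ω / 2) := by
    rw [← Complex.exp_add]; ring_nf
  have h2 : cexp (2 * I * x + I * π * ω / 2) *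
      (cexp (2 * π * I * ((x + y) / π + ω / 2 + 1 / 2) + π * I * ω) *
      cexp (-π * I * (2 * ω + 2 * (2 * x / π + 1)))) = -cexp (2 * I * y + I * π * ω / 2) := by
    rw [← Complex.exp_add, ← Complex.exp_add, ← Complex.exp_sub_pi_mul_I]
    congr 1
    field_simp
    ring
  linear_combination (I ^ 2 * jacobiTheta₂ ((x + y) / π + ω / 2 + 1 / 2) ω *
    jacobiTheta₂ ((x - y) / π + ω / 2 + 1 / 2) ω) * h1 +
    I ^ 2 * cexp (2 * I * x + I * π * ω / 2) * hmul +
    (I ^ 2 * jacobiTheta₂ (2 * x / π) (2 * ω) * jacobiTheta₂ (2 * y / π + ω) (2 * ω)) * h2 +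
    (cexp (2 * I * x + I * π * ω / 2) * jacobiTheta₂ (2 * x / π + ω) (2 * ω) *
      jacobiTheta₂ (2 * y / π) (2 * ω) - cexp (2 * I * y + I * π * ω / 2) *
      jacobiTheta₂ (2 * x / π) (2 * ω) * jacobiTheta₂ (2 * y / π + ω) (2 * ω)) * I_sq

/-- Weierstrass' three-term identity. -/
theorem theta_three_term (hω : 0 < ω.im) (x y z w : ℂ) :
    theta ω (x + y) * theta ω (x - y) * (theta ω (z + w) * theta ω (z - w)) -
      theta ω (x + z) * theta ω (x - z) * (theta ω (y + w) * theta ω (y - w)) +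
      theta ω (x + w) * theta ω (x - w) * (theta ω (y + z) * theta ω (y - z)) = 0 := by
  -- With every product a 2 × 2 minor, the claim is the Plücker relation for four vectors in a
  -- plane.
  obtain ⟨F, G, h⟩ := exists_theta_add_mul_theta_sub hω
  simp only [h]
  ring

/-- At a zero `u` the three-term identity loses a term. What remains forces θ(x)/θ(x - u) to have a
constant logarithmic derivative `B`, so θ(x)e^{-Bx} = Aθ(x - u). Comparing the quasi-periods of both
sides quantizes `B` and puts `u` in Γ. -/
theorem theta_eq_zero (hω : 0 < ω.im) {u : ℂ} (hu : theta ω u = 0) : u ∈ lattice ω := by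
  have hd := differentiable_theta hω
  set f : ℂ → ℂ := theta ω with hf
  have hdf : ∀ x, HasDerivAt f (deriv f x) x := fun x => (hd x).hasDerivAt
  have hquad : ∀ x y z, f (x + z) * f (x - z) * (f (y + z - u) * f (y - z + u)) =
      f (x + z - u) * f (x - z + u) * (f (y + z) * f (y - z)) := by
    intro x y z
    have := theta_three_term hω x y z (z - u)
    rw [← hf, show z - (z - u) = u by ring, hu] at this
    rw [show x + (z - u) = x + z - u by ring, show x - (z - u) = x - z + u by ring,
      show y + (z - u) = y + z - u by ring, show y - (z - u) = y - z + u by ring] at this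
    linear_combination -this
  set g : ℂ → ℂ := fun x => f (x - u) with hg
  have hdg : ∀ x, HasDerivAt g (deriv f (x - u)) x := fun x =>
    (hdf (x - u)).comp_sub_const x u
  have hodd : ∀ x, f (-x) = -f x := theta_neg ω
  have hodd' : ∀ x, deriv f (-x) = deriv f x := by
    intro x
    have h1 : HasDerivAt (fun y => f (-y)) (deriv f (-x) * -1) x :=
      (hdf (-x)).comp x (hasDerivAt_neg x)
    have h2 : HasDerivAt (fun y => f (-y)) (-deriv f x) x := by
      simp only [hodd]
      exact (hdf x).neg
    linear_combination -(h1.unique h2)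
  have hW : ∀ X Y, (deriv f X * g X - f X * deriv f (X - u)) * (f Y * g Y) =
      (deriv f Y * g Y - f Y * deriv f (Y - u)) * (f X * g X) := by
    intro X Y
    -- The identity is trivial when its first two arguments agree; its first-order term there
    -- separates the variables `X` and `Y`.
    have key := fun t => hquad t ((X - Y) / 2) ((X + Y) / 2)
    have e : ∀ s, HasDerivAt (fun t => f (t + s)) (deriv f ((X - Y) / 2 + s)) ((X - Y) / 2) := by
      intro s
      exact (hdf ((X - Y) / 2 + s)).comp_add_const ((X - Y) / 2) s
    have hL := (((e ((X + Y) / 2)).mul (e (-((X + Y) / 2)))).mul_const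
      (f ((X - Y) / 2 + (X + Y) / 2 - u) * f ((X - Y) / 2 - (X + Y) / 2 + u)))
    have hR := (((e ((X + Y) / 2 - u)).mul (e (-((X + Y) / 2) + u))).mul_const
      (f ((X - Y) / 2 + (X + Y) / 2) * f ((X - Y) / 2 - (X + Y) / 2)))
    have := hL.unique (hR.congr_of_eventuallyEq (Filter.Eventually.of_forall fun t => by
      have := key t
      simp only [Pi.mul_apply]
      rw [show t + ((X + Y) / 2 - u) = t + (X + Y) / 2 - u by ring,
        show t + (-((X + Y) / 2) + u) = t - (X + Y) / 2 + u by ring, ← sub_eq_add_neg]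
      exact this))
    rw [show (X - Y) / 2 + (X + Y) / 2 = X by ring, show (X - Y) / 2 - (X + Y) / 2 = -Y by ring,
      show (X - Y) / 2 + -((X + Y) / 2) = -Y by ring,
      show (X - Y) / 2 + (-((X + Y) / 2) + u) = -(Y - u) by ring,
      show -Y + u = -(Y - u) by ring,
      show (X - Y) / 2 + ((X + Y) / 2 - u) = X - u by ring] at this
    simp only [hodd, hodd'] at this
    simp only [hg]
    linear_combination this
  have hfa : AnalyticOnNhd ℂ f Set.univ := fun x _ => hd.analyticAt x
  have hgd : Differentiable ℂ g := fun x => (hdg x).differentiableAt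
  have hga : AnalyticOnNhd ℂ g Set.univ := fun x _ => hgd.analyticAt x
  obtain ⟨z0, hz0⟩ := theta_not_forall_eq_zero hω
  obtain ⟨Y, hY⟩ : ∃ Y, f Y * g Y ≠ 0 := by
    by_contra! h
    rcases hfa.eq_zero_or_eq_zero_of_mul_eq_zero hga (fun x _ => h x) isPreconnected_univ with h | h
    · exact hz0 (h z0 trivial)
    · exact hz0 (by simpa [hg] using h (z0 + u) trivial)
  obtain ⟨B, hB⟩ : ∃ B, ∀ X, deriv f X * g X - f X * deriv f (X - u) = B * (f X * g X) :=
    ⟨(deriv f Y * g Y - f Y * deriv f (Y - u)) / (f Y * g Y), fun X => by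
      rw [div_mul_eq_mul_div, eq_div_iff hY]
      exact hW X Y⟩
  have hfY := left_ne_zero_of_mul hY
  have hgY := right_ne_zero_of_mul hY
  have hE : ∀ x, HasDerivAt (fun x => cexp (-(B * x))) (cexp (-(B * x)) * -B) x := fun x => by
    simpa using ((hasDerivAt_id x).const_mul B).neg.cexp
  -- The quotient is constant near `Y`, where `g` does not vanish; the identity theorem extends the
  -- relation, cleared of denominators, to the plane.
  obtain ⟨A, hA⟩ : ∃ A, ∀ x, f x * cexp (-(B * x)) = A * g x := by
    have hev : ∀ᶠ x in nhds Y, g x ≠ 0 := hgd.continuous.continuousAt.eventually_ne hgY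
    obtain ⟨ε, hε, hball⟩ := Metric.eventually_nhds_iff_ball.1 hev
    let q : ℂ → ℂ := fun x => f x * cexp (-(B * x)) / g x
    have hq : ∀ x ∈ Metric.ball Y ε, HasDerivAt q 0 x := by
      intro x hx
      have h := ((hdf x).mul (hE x)).div (hdg x) (hball x hx)
      rw [Pi.mul_apply, show (deriv f x * cexp (-(B * x)) + f x * (cexp (-(B * x)) * -B)) * g x -
        f x * cexp (-(B * x)) * deriv f (x - u) = 0 by
          linear_combination cexp (-(B * x)) * hB x, zero_div] at h
      exact h
    have hconst : ∀ x ∈ Metric.ball Y ε, q x = q Y := by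
      intro x hx
      exact Metric.isOpen_ball.is_const_of_deriv_eq_zero (convex_ball Y ε).isPreconnected
        (fun y hy => (hq y hy).differentiableAt.differentiableWithinAt)
        (fun y hy => (hq y hy).deriv) hx (Metric.mem_ball_self hε)
    refine ⟨q Y, fun x => ?_⟩
    have hl : AnalyticOnNhd ℂ (fun x => f x * cexp (-(B * x))) Set.univ := fun x _ =>
      (hd.mul (fun x => (hE x).differentiableAt)).analyticAt x
    have hr : AnalyticOnNhd ℂ (fun x => q Y * g x) Set.univ := fun x _ =>
      (hgd.const_mul (q Y)).analyticAt x
    refine congrFun (hl.eq_of_eventuallyEq hr (z₀ := Y) ?_) x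
    filter_upwards [Metric.ball_mem_nhds Y hε] with x hx
    rw [← hconst x hx]
    exact (div_mul_cancel₀ _ (hball x hx)).symm
  have hAg : A * g Y ≠ 0 := by
    rw [← hA]
    exact mul_ne_zero hfY (Complex.exp_ne_zero _)
  -- θ(x) and θ(x - u) get the same factor under translation by π, and factors differing by e^{2iu}
  -- under translation by πω.
  have h1 : cexp (-(B * π)) = 1 := by
    have h := hA (Y + π)
    have h' := hA Y
    rw [show -(B * (Y + π)) = -(B * Y) + -(B * π) by ring, Complex.exp_add] at h
    simp only [hg, hf, show Y + π - u = Y - u + π by ring, theta_add_pi] at h h'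
    refine mul_left_cancel₀ hAg ?_
    simp only [hg, hf]
    linear_combination -h - cexp (-(B * π)) * h'
  have h2 : cexp (-(B * (π * ω))) = cexp (2 * I * u) := by
    have h := hA (Y + π * ω)
    have h' := hA Y
    rw [show -(B * (Y + π * ω)) = -(B * Y) + -(B * (π * ω)) by ring, Complex.exp_add] at h
    simp only [hg, hf, show Y + π * ω - u = Y - u + π * ω by ring, theta_add_pi_mul] at h h'
    rw [show -(I * π * ω) - 2 * I * (Y - u) = -(I * π * ω) - 2 * I * Y + 2 * I * u by ring,
      Complex.exp_add _ (2 * I * u)] at h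
    refine mul_left_cancel₀ (mul_ne_zero (Complex.exp_ne_zero (-(I * π * ω) - 2 * I * Y)) hAg) ?_
    simp only [hg, hf]
    linear_combination -h - cexp (-(I * π * ω) - 2 * I * Y) * cexp (-(B * (π * ω))) * h'
  rw [Complex.exp_eq_one_iff] at h1
  obtain ⟨n, hn⟩ := h1
  rw [Complex.exp_eq_exp_iff_exists_int] at h2
  obtain ⟨m, hm⟩ := h2
  have hp : (π : ℂ) ≠ 0 := by exact_mod_cast Real.pi_ne_zero
  have hBn : B = -(2 * n * I) := by
    refine mul_right_cancel₀ hp ?_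
    linear_combination -hn
  refine ⟨-m, n, ?_⟩
  rw [hBn] at hm
  refine mul_left_cancel₀ (mul_ne_zero two_ne_zero I_ne_zero) ?_
  push_cast
  linear_combination -hm

theorem lattice_countable (ω : ℂ) : (lattice ω).Countable := by
  have : lattice ω = Set.range fun p : ℤ × ℤ => (π : ℂ) * p.1 + π * ω * p.2 := by
    ext z
    simp [lattice, eq_comm]
  rw [this]
  exact Set.countable_range _

end Theta

/-- The eigenvalue `1 - 2 i` of `σ^z` on the basis vector `|i⟩`. -/
def spinSign (i : Fin 2) : ℂ := 1 - 2 * ((i : ℕ) : ℂ)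

@[simp] theorem spinSign_zero : spinSign 0 = 1 := by simp [spinSign]
@[simp] theorem spinSign_one : spinSign 1 = -1 := by norm_num [spinSign]

/-! ### R-matrix weights and the dynamical Yang-Baxter equation. -/

namespace Params

variable {N : ℕ} (P : Params N)

theorem th_neg (z : ℂ) : P.th (-z) = -P.th z := theta_neg _ _

theorem th_zero : P.th 0 = 0 := theta_zero _

theorem th_three_term (hω : 0 < P.ω.im) (x y z w : ℂ) :
    P.th (x + y) * P.th (x - y) * (P.th (z + w) * P.th (z - w)) -
      P.th (x + z) * P.th (x - z) * (P.th (y + w) * P.th (y - w)) +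
      P.th (x + w) * P.th (x - w) * (P.th (y + z) * P.th (y - z)) = 0 :=
  theta_three_term hω x y z w

theorem weight_of_R_ne_zero {l t : ℂ} {i j i' j' : Fin 2} (h : P.R l t (i, j) (i', j') ≠ 0) :
    (i : ℕ) + j = i' + j' := by
  by_contra hne
  refine h ?_
  fin_cases i <;> fin_cases j <;> fin_cases i' <;> fin_cases j' <;> simp at hne <;> rfl

theorem R_eq_zero {l t : ℂ} {i j i' j' : Fin 2} (h : (i : ℕ) + j ≠ i' + j') :
    P.R l t (i, j) (i', j') = 0 := by
  by_contra hne
  exact h (P.weight_of_R_ne_zero hne)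

theorem spinSign_add_of_R_ne_zero {l t : ℂ} {i j i' j' : Fin 2}
    (h : P.R l t (i, j) (i', j') ≠ 0) : spinSign i + spinSign j = spinSign i' + spinSign j' := by
  have : (i : ℂ) + j = i' + j' := by exact_mod_cast P.weight_of_R_ne_zero h
  simp only [spinSign]
  linear_combination (-2) * this

theorem R_00 (l t : ℂ) : P.R l t (0, 0) (0, 0) = P.wa l := rfl
theorem R_11 (l t : ℂ) : P.R l t (1, 1) (1, 1) = P.wa l := rfl
theorem R_01_01 (l t : ℂ) :
    P.R l t (0, 1) (0, 1) = cexp (I * P.y * P.η) * P.wb l t := rfl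
theorem R_01_10 (l t : ℂ) :
    P.R l t (0, 1) (1, 0) = cexp (I * P.y * l) * P.wc l t := rfl
theorem R_10_01 (l t : ℂ) :
    P.R l t (1, 0) (0, 1) = cexp (-(I * P.y * l)) * P.wc l (-t) := rfl
theorem R_10_10 (l t : ℂ) :
    P.R l t (1, 0) (1, 0) = cexp (-(I * P.y * P.η)) * P.wb l (-t) := rfl

/-- The three-term identity at (p ± q)/2, (r ± s)/2. The arguments on the right are free variables
so that each use can give them the shape they have in the weights. -/
theorem th_mul_four (hω : 0 < P.ω.im) {p q r s : ℂ} (a₁ a₂ a₃ a₄ b₁ b₂ b₃ b₄ : ℂ)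
    (h : 2 * a₁ = p + q + r + s) (h₂ : a₂ = a₁ - r - s) (h₃ : a₃ = a₁ - q - s)
    (h₄ : a₄ = a₁ - q - r) (k₁ : b₁ = a₁ - s) (k₂ : b₂ = a₁ - r) (k₃ : b₃ = a₁ - q)
    (k₄ : b₄ = a₁ - p) :
    P.th p * P.th q * P.th r * P.th s =
      P.th a₁ * P.th a₂ * P.th a₃ * P.th a₄ + P.th b₁ * P.th b₂ * P.th b₃ * P.th b₄ := by
  have key := P.th_three_term hω ((p + q) / 2) ((p - q) / 2) ((r + s) / 2) ((r - s) / 2)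
  rw [show (p + q) / 2 + (p - q) / 2 = p by ring, show (p + q) / 2 - (p - q) / 2 = q by ring,
    show (r + s) / 2 + (r - s) / 2 = r by ring, show (r + s) / 2 - (r - s) / 2 = s by ring,
    show (p + q) / 2 + (r + s) / 2 = a₁ by linear_combination -h / 2,
    show (p + q) / 2 - (r + s) / 2 = a₂ by linear_combination -h / 2 - h₂,
    show (p - q) / 2 + (r - s) / 2 = a₃ by linear_combination -h / 2 - h₃,
    show (p - q) / 2 - (r - s) / 2 = a₄ by linear_combination -h / 2 - h₄,
    show (p + q) / 2 + (r - s) / 2 = b₁ by linear_combination -h / 2 - k₁,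
    show (p + q) / 2 - (r - s) / 2 = b₂ by linear_combination -h / 2 - k₂,
    show (p - q) / 2 + (r + s) / 2 = b₃ by linear_combination -h / 2 - k₃,
    show (p - q) / 2 - (r + s) / 2 = -b₄ by linear_combination h / 2 + k₄, P.th_neg] at key
  linear_combination key

theorem wb_mul_wb_comm (l m t s : ℂ) : P.wb l t * P.wb m s = P.wb m t * P.wb l s := by
  simp only [wb]
  ring

theorem wb_neg (l t : ℂ) : P.wb l (-t) = P.th l * P.th (t - P.η) / P.th t := by
  rw [wb, P.th_neg, show -t + P.η = -(t - P.η) by ring, P.th_neg]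
  rw [mul_neg, neg_div_neg_eq]

theorem wc_neg (l t : ℂ) : P.wc l (-t) = P.th P.η * P.th (t - l) / P.th t := by
  rw [wc, P.th_neg, show -t + l = -(t - l) by ring, P.th_neg]
  rw [mul_neg, neg_div_neg_eq]

/-- The digits give the row and the column of an entry of the Yang-Baxter equation. The seven
`weights` lemmas treat the sector with one down spin, stripped of the exponential factors. -/
theorem weights_001_010 {l m u t s : ℂ} (hω : 0 < P.ω.im) (hu : u = l - m)
    (hs : s = t + P.η) (ht : P.th t ≠ 0) (hts : P.th s ≠ 0) :
    P.wa u * P.wb l t * P.wc m s =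
    P.wc m t * P.wa l * P.wb u t + P.wb m t * P.wc l s * P.wc u (-t) := by
  subst hs
  have k := P.th_mul_four hω (p := u + P.η) (q := l) (r := t + P.η + m) (s := t)
    (t + P.η + l) (-(t - u)) P.η (-m) (l + P.η) u (t + P.η) (t + m)
    (by rw [hu]; ring) (by rw [hu]; ring) (by ring) (by ring) (by ring) (by rw [hu]; ring)
    (by ring) (by rw [hu]; ring)
  simp only [P.th_neg] at k
  rw [P.wc_neg, wa, wa, wb, wb, wb, wc, wc, wc]
  field_simp
  linear_combination P.th P.η * k

theorem weights_001_100 {l m u t s : ℂ} (hω : 0 < P.ω.im) (hu : u = l - m)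
    (hs : s = t + P.η) (ht : P.th t ≠ 0) (hts : P.th s ≠ 0) :
    P.wa u * P.wc l t * P.wa m =
    P.wc m t * P.wa l * P.wc u t + P.wb m t * P.wc l s * P.wb u (-t) := by
  subst hs
  have k := P.th_mul_four hω (p := u + P.η) (q := m + P.η) (r := t + l) (s := t)
    (t + P.η + l) (-(t - P.η)) u (-m) (l + P.η) P.η (t + u) (t + m)
    (by rw [hu]; ring) (by ring) (by rw [hu]; ring) (by ring) (by ring) (by ring)
    (by rw [hu]; ring) (by rw [hu]; ring)
  simp only [P.th_neg] at k
  rw [P.wb_neg, wa, wa, wa, wb, wc, wc, wc, wc]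
  field_simp
  linear_combination P.th P.η * k

theorem weights_010_001 {l m u t s : ℂ} (hω : 0 < P.ω.im) (hu : u = l - m)
    (hs : s = t + P.η) (ht : P.th t ≠ 0) (hts : P.th s ≠ 0) :
    P.wb u s * P.wa l * P.wc m (-s) + P.wc u s * P.wc l (-t) * P.wb m s =
    P.wc m (-t) * P.wb l s * P.wa u := by
  subst hs
  have k := P.th_mul_four hω (p := u + P.η) (q := l) (r := t - m) (s := t + P.η)
    (t + P.η + u) (-(t - l)) (-m) P.η u (l + P.η) (t + P.η - m) t
    (by rw [hu]; ring) (by rw [hu]; ring) (by rw [hu]; ring) (by rw [hu]; ring) (by ring)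
    (by rw [hu]; ring) (by rw [hu]; ring) (by ring)
  simp only [P.th_neg] at k
  rw [P.wc_neg, P.wc_neg, P.wc_neg, wa, wa, wb, wb, wb, wc]
  field_simp
  linear_combination -(P.th P.η * P.th (t + P.η + P.η)) * k

theorem weights_010_100 {l m u t s : ℂ} (hω : 0 < P.ω.im) (hu : u = l - m)
    (hs : s = t + P.η) (ht : P.th t ≠ 0) (hts : P.th s ≠ 0) :
    P.wc u s * P.wb l (-t) * P.wa m =
    P.wb m (-t) * P.wa l * P.wc u t + P.wc m (-t) * P.wc l s * P.wb u (-t) := by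
  subst hs
  have k := P.th_mul_four hω (p := m + P.η) (q := l) (r := t + P.η + u) (s := t)
    (t + P.η + l) (-(t - m)) P.η (-u) (l + P.η) m (t + P.η) (t + u)
    (by rw [hu]; ring) (by rw [hu]; ring) (by ring) (by ring) (by ring) (by rw [hu]; ring)
    (by ring) (by rw [hu]; ring)
  simp only [P.th_neg] at k
  rw [P.wc_neg, P.wb_neg, P.wb_neg, P.wb_neg, wa, wa, wc, wc, wc]
  field_simp
  linear_combination P.th P.η * P.th (t - P.η) * k

theorem weights_100_001 {l m u t s : ℂ} (hω : 0 < P.ω.im) (hu : u = l - m)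
    (hs : s = t + P.η) (ht : P.th t ≠ 0) (hts : P.th s ≠ 0) :
    P.wc u (-s) * P.wa l * P.wc m (-s) + P.wb u (-s) * P.wc l (-t) * P.wb m s =
    P.wa m * P.wc l (-s) * P.wa u := by
  have hst : s - P.η = t := by rw [hs]; ring
  have k := P.th_mul_four hω (p := m + P.η) (q := u + P.η) (r := s - l) (s := s)
    (s + P.η) (-(t - l)) (-u) m P.η (l + P.η) (s - u) (s - m)
    (by rw [hu]; ring) (by rw [hs]; ring) (by ring) (by rw [hu]; ring) (by ring) (by ring)
    (by ring) (by ring)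
  simp only [P.th_neg] at k
  rw [P.wc_neg, P.wc_neg, P.wc_neg, P.wc_neg, P.wb_neg, hst, wa, wa, wa, wb]
  field_simp
  linear_combination -(P.th P.η) * k

theorem weights_100_010 {l m u t s : ℂ} (hω : 0 < P.ω.im) (hu : u = l - m)
    (hs : s = t + P.η) (ht : P.th t ≠ 0) (hts : P.th s ≠ 0) :
    P.wc u (-s) * P.wa l * P.wb m (-s) + P.wb u (-s) * P.wc l (-t) * P.wc m s =
    P.wa m * P.wb l (-s) * P.wc u (-t) := by
  have hst : s - P.η = t := by rw [hs]; ring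
  have k := P.th_mul_four hω (p := m + P.η) (q := l) (r := t - u) (s := s)
    (s + m) (-(t - l)) (-u) P.η m (l + P.η) (s - u) t
    (by rw [hu, hs]; ring) (by rw [hu]; ring) (by rw [hu]; ring) (by rw [hu, hs]; ring) (by ring)
    (by rw [hu, hs]; ring) (by rw [hu]; ring) (by rw [hs]; ring)
  simp only [P.th_neg] at k
  rw [P.wc_neg, P.wc_neg, P.wc_neg, P.wb_neg, P.wb_neg, P.wb_neg, hst, wa, wa, wc]
  field_simp
  linear_combination -(P.th P.η) * k

theorem weights_010_010 {l m u t s : ℂ} (hω : 0 < P.ω.im) (hu : u = l - m)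
    (hs : s = t + P.η) (ht : P.th t ≠ 0) (hts : P.th s ≠ 0) :
    P.wb u s * P.wa l * P.wb m (-s) + P.wc u s * P.wc l (-t) * P.wc m s =
      P.wb m (-t) * P.wa l * P.wb u t + P.wc m (-t) * P.wc l s * P.wc u (-t) := by
  have hst : s - P.η = t := by rw [hs]; ring
  -- By `k₁` the difference of the two `ccc` terms is a multiple of θ(s + t), and `k₂` identifies it
  -- with the difference of the two `bab` terms.
  have k₁ := P.th_mul_four hω (p := s + u) (q := s + m) (r := t - l) (s := t)
    (s + t) (l + P.η) (-m) u s (s + l) (t - m) (t - u)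
    (by rw [hu]; ring) (by rw [hs]; ring) (by ring) (by rw [hu]; ring) (by ring) (by ring)
    (by ring) (by ring)
  have k₂ := P.th_mul_four hω (p := s + P.η) (q := t) (r := t) (s := t)
    (s + t) P.η P.η P.η s s s (t - P.η)
    (by rw [hs]; ring) (by rw [hs]; ring) (by rw [hs]; ring) (by rw [hs]; ring) (by rw [hs]; ring)
    (by rw [hs]; ring) (by rw [hs]; ring) (by rw [hs]; ring)
  simp only [P.th_neg] at k₁ k₂
  rw [P.wc_neg, P.wc_neg, P.wc_neg, P.wb_neg, P.wb_neg, hst, wa, wb, wb, wc, wc, wc, ← hs]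
  field_simp
  linear_combination P.th P.η ^ 3 * k₁ + P.th u * P.th m * P.th (l + P.η) * k₂

theorem dynamical_yang_baxter_of_weight_ne (l m t₁ t₂ t₃ t₄ t₅ : ℂ) (u : Fin 2 → ℂ)
    (i j k i' j' k' : Fin 2) (h : (i : ℕ) + j + k ≠ i' + j' + k') :
    ∑ a, ∑ b, ∑ c, P.R (l - m) t₁ (i, j) (a, b) * P.R l t₂ (a, k) (i', c) *
        P.R m t₃ (b, c) (j', k') =
      ∑ a, ∑ b, ∑ c, P.R m t₄ (j, k) (b, c) * P.R l (u b) (i, c) (a, k') *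
        P.R (l - m) t₅ (a, b) (i', j') := by
  trans 0
  · refine Finset.sum_eq_zero fun a _ => Finset.sum_eq_zero fun b _ =>
      Finset.sum_eq_zero fun c _ => ?_
    by_contra hne
    have h₁ := P.weight_of_R_ne_zero (left_ne_zero_of_mul (left_ne_zero_of_mul hne))
    have h₂ := P.weight_of_R_ne_zero (right_ne_zero_of_mul (left_ne_zero_of_mul hne))
    have h₃ := P.weight_of_R_ne_zero (right_ne_zero_of_mul hne)
    omega
  · refine (Finset.sum_eq_zero fun a _ => Finset.sum_eq_zero fun b _ =>
      Finset.sum_eq_zero fun c _ => ?_).symm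
    by_contra hne
    have h₁ := P.weight_of_R_ne_zero (left_ne_zero_of_mul (left_ne_zero_of_mul hne))
    have h₂ := P.weight_of_R_ne_zero (right_ne_zero_of_mul (left_ne_zero_of_mul hne))
    have h₃ := P.weight_of_R_ne_zero (right_ne_zero_of_mul hne)
    omega

/-- Both sides conserve the number of down spins. The sector with two down spins is the sector with
one, taken at `-t`: flipping all spins exchanges the weights at `t` and `-t`. The exponentials match
since those of `u = l - m` are quotients of those of `l` and `m`. -/
theorem dynamical_yang_baxter (hω : 0 < P.ω.im) (l m t : ℂ)
    (ht : P.th t ≠ 0) (ht₁ : P.th (t + P.η) ≠ 0) (ht₂ : P.th (t - P.η) ≠ 0)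
    (i j k i' j' k' : Fin 2) :
    ∑ a, ∑ b, ∑ c, P.R (l - m) (t + P.η * spinSign k) (i, j) (a, b) * P.R l t (a, k) (i', c) *
        P.R m (t + P.η * spinSign i') (b, c) (j', k') =
      ∑ a, ∑ b, ∑ c, P.R m t (j, k) (b, c) * P.R l (t + P.η * spinSign b) (i, c) (a, k') *
        P.R (l - m) t (a, b) (i', j') := by
  by_cases hw : (i : ℕ) + j + k = i' + j' + k'
  swap
  · exact P.dynamical_yang_baxter_of_weight_ne l m _ _ _ _ _ (fun b => t + P.η * spinSign b)
      i j k i' j' k' hw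
  have z : ∀ {l t : ℂ} {i j i' j' : Fin 2}, (i : ℕ) + j ≠ i' + j' →
    P.R l t (i, j) (i', j') = 0 := P.R_eq_zero
  obtain ⟨u, hu⟩ : ∃ u, u = l - m := ⟨_, rfl⟩
  obtain ⟨s, hs⟩ : ∃ s, s = t + P.η := ⟨_, rfl⟩
  obtain ⟨s', hs'⟩ : ∃ s', s' = t - P.η := ⟨_, rfl⟩
  have hs'' : -s' = -t + P.η := by rw [hs']; ring
  have hnt : P.th (-t) ≠ 0 := by rw [P.th_neg]; exact neg_ne_zero.2 ht
  have hns : P.th (-s') ≠ 0 := by rw [P.th_neg, hs']; exact neg_ne_zero.2 ht₂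
  rw [← hs] at ht₁
  have hXu : cexp (I * P.y * u) = cexp (I * P.y * l) * (cexp (I * P.y * m))⁻¹ := by
    rw [← Complex.exp_neg, ← Complex.exp_add, hu]; ring_nf
  rw [← hu]
  have hE := Complex.exp_ne_zero (I * P.y * P.η)
  have hX := Complex.exp_ne_zero (I * P.y * l)
  have hM := Complex.exp_ne_zero (I * P.y * m)
  have c1 := P.weights_001_010 hω hu hs ht ht₁
  have c2 := P.weights_001_100 hω hu hs ht ht₁
  have c3 := P.weights_010_001 hω hu hs ht ht₁
  have c4 := P.weights_010_010 hω hu hs ht ht₁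
  have c5 := P.weights_010_100 hω hu hs ht ht₁
  have c6 := P.weights_100_001 hω hu hs ht ht₁
  have c7 := P.weights_100_010 hω hu hs ht ht₁
  have d1 := P.weights_001_010 hω hu hs'' hnt hns
  have d2 := P.weights_001_100 hω hu hs'' hnt hns
  have d3 := P.weights_010_001 hω hu hs'' hnt hns
  have d4 := P.weights_010_010 hω hu hs'' hnt hns
  have d5 := P.weights_010_100 hω hu hs'' hnt hns
  have d6 := P.weights_100_001 hω hu hs'' hnt hns
  have d7 := P.weights_100_010 hω hu hs'' hnt hns
  simp only [neg_neg] at d1 d2 d3 d4 d5 d6 d7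
  fin_cases i <;> fin_cases j <;> fin_cases k <;> fin_cases i' <;> fin_cases j' <;>
    fin_cases k' <;> first | (exfalso; revert hw; decide) | skip
  all_goals
    simp (disch := decide) only [Fin.sum_univ_two, z, R_00, R_11, R_01_01, R_01_10, R_10_01,
      R_10_10, mul_zero, zero_mul, add_zero, zero_add, Fin.mk_zero, Fin.mk_one,
      spinSign_zero, spinSign_one, mul_one, mul_neg, ← sub_eq_add_neg, ← hs, ← hs',
      Complex.exp_neg, hXu]
  all_goals try ring1
  all_goals generalize cexp (I * P.y * P.η) = E at *
  all_goals generalize cexp (I * P.y * l) = X at *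
  all_goals generalize cexp (I * P.y * m) = M at *
  all_goals try field_simp
  all_goals first
    | linear_combination c1
    | linear_combination c2
    | linear_combination c3
    | linear_combination c4
    | linear_combination c5
    | linear_combination c6
    | linear_combination c7
    | linear_combination d1
    | linear_combination d2
    | linear_combination d3
    | linear_combination d4
    | linear_combination d5
    | linear_combination d6
    | linear_combination d7
    -- The entries left are diagonal, with the exceptional spin at an end; there two `b` weights
    -- merely trade spectral parameters.
    | linear_combination P.wa u * P.wb_mul_wb_comm l m t s
    | linear_combination P.wa m * P.wb_mul_wb_comm u l s' t
    | linear_combination P.wa m * P.wb_mul_wb_comm u l (-s) (-t)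
    | linear_combination P.wa u * P.wb_mul_wb_comm l m (-t) (-s')

end Params

/-! ### The monodromy matrix: recursion on the sites and exchange relations. -/

namespace Params

section Recursion

variable {N : ℕ} (P : Params (N + 1))

/-- The model without its first site. -/
def tail : Params N where
  ω := P.ω
  η := P.η
  x := P.x
  y := P.y
  ξ n := P.ξ n.succ

theorem tail_R (l t : ℂ) : P.tail.R l t = P.R l t := rfl
theorem tail_th (z : ℂ) : P.tail.th z = P.th z := rfl
theorem tail_wa (z : ℂ) : P.tail.wa z = P.wa z := rfl
theorem tail_η : P.tail.η = P.η := rfl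
theorem tail_y : P.tail.y = P.y := rfl
theorem tail_ξ (n : Fin N) : P.tail.ξ n = P.ξ n.succ := rfl

theorem sum_spins_succ (f : Spins (N + 1) → ℂ) :
    ∑ h, f h = ∑ s : Fin 2, ∑ h : Spins N, f (Fin.cons s h) := by
  rw [← (Fin.consEquiv fun _ : Fin (N + 1) => Fin 2).sum_comp, Fintype.sum_prod_type]
  rfl

theorem siteR_zero (l t : ℂ) (i j s s' : Fin 2) (h h' : Spins N) :
    P.siteR l t 0 (i, Fin.cons s h) (j, Fin.cons s' h') =
      if h = h' then P.R (l - P.ξ 0) t (i, s) (j, s') else 0 := by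
  have : (∀ m : Fin (N + 1), m ≠ 0 → (Fin.cons s h : Spins (N + 1)) m =
      (Fin.cons s' h' : Spins (N + 1)) m) ↔ h = h' := by
    simp [Fin.forall_fin_succ, funext_iff]
  simp [siteR, this]

theorem siteR_succ (l t : ℂ) (n : Fin N) (i j s s' : Fin 2) (h h' : Spins N) :
    P.siteR l t n.succ (i, Fin.cons s h) (j, Fin.cons s' h') =
      if s = s' then P.tail.siteR l (t + P.η * spinSign s) n (i, h) (j, h') else 0 := by
  have : (∀ m : Fin (N + 1), m ≠ n.succ → (Fin.cons s h : Spins (N + 1)) m =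
      (Fin.cons s' h' : Spins (N + 1)) m) ↔ s = s' ∧ ∀ m, m ≠ n → h m = h' m := by
    simp [Fin.forall_fin_succ, eq_comm (a := (0 : Fin (N + 1)))]
  simp only [siteR, this, tail_R, tail_ξ, tail_η]
  by_cases hs : s = s'
  · subst hs
    simp only [true_and, if_true, Fin.cons_succ]
    congr 2
    rw [Finset.sum_filter, Fin.sum_univ_succ, Finset.sum_filter]
    simp only [Fin.succ_pos, if_true, Fin.cons_zero, Fin.cons_succ, Fin.succ_lt_succ_iff, spinSign]
    ring
  · simp [hs]

theorem prod_siteR_succ (l t : ℂ) (L : List (Fin N)) (i j s s' : Fin 2) (h h' : Spins N) :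
    (L.map fun n => P.siteR l t n.succ).prod (i, Fin.cons s h) (j, Fin.cons s' h') =
      if s = s' then
        (L.map fun n => P.tail.siteR l (t + P.η * spinSign s) n).prod (i, h) (j, h') else 0 := by
  induction L generalizing i s h with
  | nil =>
    by_cases hs : s = s' <;> simp [Matrix.one_apply, hs]
  | cons n L ih =>
    simp only [List.map_cons, List.prod_cons, Matrix.mul_apply, Fintype.sum_prod_type,
      sum_spins_succ, siteR_succ, ih]
    by_cases hs : s = s'
    · subst hs
      simp
    · simp only [ite_mul, zero_mul, mul_ite, mul_zero, hs, if_false]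
      refine Finset.sum_eq_zero fun a _ => Finset.sum_eq_zero fun b _ =>
        Finset.sum_eq_zero fun c _ => ?_
      split_ifs <;> simp_all

/-- `R_{0,1}` is the rightmost factor and acts first, so the remaining sites see the dynamical
parameter shifted by the spin `s` it leaves behind. -/
theorem monodromyEntry_succ (l t : ℂ) (i j s s' : Fin 2) (h h' : Spins N) :
    P.monodromyEntry i j l t (Fin.cons s h) (Fin.cons s' h') =
      ∑ k, P.tail.monodromyEntry i k l (t + P.η * spinSign s) h h' *
        P.R (l - P.ξ 0) t (k, s) (j, s') := by
  simp only [monodromyEntry, monodromy, List.ofFn_succ, List.reverse_cons, List.prod_append,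
    List.prod_singleton, Matrix.mul_apply, Fintype.sum_prod_type, sum_spins_succ, siteR_zero]
  simp only [List.ofFn_eq_map, ← List.map_reverse, prod_siteR_succ]
  simp

end Recursion

theorem monodromyEntry_of_isEmpty (P : Params 0) (l t : ℂ) (i j : Fin 2) (h h' : Spins 0) :
    P.monodromyEntry i j l t h h' = if i = j then 1 else 0 := by
  simp [monodromyEntry, monodromy, Matrix.one_apply, Subsingleton.elim h h']

/-- No R-matrix weight has a pole at `t` or at one of its translates by multiples of `η`. -/
def Regular {N : ℕ} (P : Params N) (t : ℂ) : Prop := ∀ k : ℤ, P.th (t + k * P.η) ≠ 0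

namespace Regular

variable {N : ℕ} {P : Params N} {t : ℂ}

theorem add_int (h : P.Regular t) (n : ℤ) : P.Regular (t + n * P.η) := fun k => by
  have := h (n + k)
  rwa [show t + n * P.η + k * P.η = t + (n + k : ℤ) * P.η by push_cast; ring]

theorem add_spinSign (h : P.Regular t) (s : Fin 2) : P.Regular (t + P.η * spinSign s) := by
  have := h.add_int (1 - 2 * (s : ℕ))
  convert this using 2
  simp only [spinSign]
  push_cast
  ring

theorem ne (h : P.Regular t) : P.th t ≠ 0 := by simpa using h 0

theorem add_ne (h : P.Regular t) : P.th (t + P.η) ≠ 0 := by simpa using h 1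

theorem sub_ne (h : P.Regular t) : P.th (t - P.η) ≠ 0 := by
  simpa [sub_eq_add_neg] using h (-1)

end Regular

theorem monodromyEntry_mul_succ {N : ℕ} (P : Params (N + 1)) (l m t : ℂ)
    (i x y s s' : Fin 2) (h h' : Spins N) :
    (P.monodromyEntry i x l t * P.monodromyEntry i y m (t + P.η * spinSign x))
        (Fin.cons s h) (Fin.cons s' h') =
      ∑ a, ∑ b, ∑ c, P.R (l - P.ξ 0) t (a, s) (x, c) *
        P.R (m - P.ξ 0) (t + P.η * spinSign x) (b, c) (y, s') *
        (P.tail.monodromyEntry i a l (t + P.η * spinSign s) *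
          P.tail.monodromyEntry i b m (t + P.η * spinSign s + P.η * spinSign a)) h h' := by
  -- Spin conservation at the first site makes the two shifts of the dynamical parameter agree
  -- wherever the weight is nonzero.
  have key : ∀ a b c, P.R (l - P.ξ 0) t (a, s) (x, c) *
      P.R (m - P.ξ 0) (t + P.η * spinSign x) (b, c) (y, s') *
      (P.tail.monodromyEntry i a l (t + P.η * spinSign s) *
        P.tail.monodromyEntry i b m (t + P.η * spinSign s + P.η * spinSign a)) h h' =
      P.R (l - P.ξ 0) t (a, s) (x, c) *
      P.R (m - P.ξ 0) (t + P.η * spinSign x) (b, c) (y, s') *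
      (P.tail.monodromyEntry i a l (t + P.η * spinSign s) *
        P.tail.monodromyEntry i b m (t + P.η * spinSign x + P.η * spinSign c)) h h' := by
    intro a b c
    by_cases h0 : P.R (l - P.ξ 0) t (a, s) (x, c) = 0
    · simp [h0]
    · have := P.spinSign_add_of_R_ne_zero h0
      rw [show t + P.η * spinSign s + P.η * spinSign a =
        t + P.η * spinSign x + P.η * spinSign c by linear_combination P.η * this]
  simp only [key]
  simp only [Matrix.mul_apply, sum_spins_succ, monodromyEntry_succ, Fin.sum_univ_two,
    Finset.mul_sum, ← Finset.sum_add_distrib]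
  refine Finset.sum_congr rfl fun g _ => ?_
  ring

/-- In the bottom row the R-matrix on the left meets two down auxiliary spins and reduces to the
scalar `a(l - m)`. The Yang-Baxter equation treats the first site, and the induction hypothesis at
the shifted parameter treats the others. -/
theorem rtt_row {N : ℕ} (P : Params N) (hω : 0 < P.ω.im) {t : ℂ} (ht : P.Regular t) (l m : ℂ)
    (j j' : Fin 2) :
    P.wa (l - m) • (P.monodromyEntry 1 j l t * P.monodromyEntry 1 j' m (t + P.η * spinSign j)) =
      ∑ a, ∑ b, P.R (l - m) t (a, b) (j, j') •
        (P.monodromyEntry 1 b m t * P.monodromyEntry 1 a l (t + P.η * spinSign b)) := by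
  induction N generalizing t j j' with
  | zero =>
    ext h h'
    simp only [Matrix.smul_apply, Matrix.sum_apply, smul_eq_mul, Matrix.mul_apply,
      monodromyEntry_of_isEmpty, Finset.univ_unique, Finset.sum_singleton]
    fin_cases j <;> fin_cases j' <;> simp [P.R_eq_zero, P.R_11]
  | succ N ih =>
    ext h h'
    obtain ⟨s, h, rfl⟩ : ∃ s g, h = Fin.cons s g := ⟨h 0, Fin.tail h, (Fin.cons_self_tail h).symm⟩
    obtain ⟨s', h', rfl⟩ : ∃ s g, h' = Fin.cons s g :=
      ⟨h' 0, Fin.tail h', (Fin.cons_self_tail h').symm⟩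
    simp only [Matrix.smul_apply, Matrix.sum_apply, smul_eq_mul, monodromyEntry_mul_succ]
    have ih' := fun a b => congrFun (congrFun (ih P.tail hω (ht.add_spinSign s) a b) h) h'
    simp only [Matrix.smul_apply, Matrix.sum_apply, smul_eq_mul, tail_R, tail_wa, tail_η] at ih'
    have yb := fun a b => P.dynamical_yang_baxter hω (l - P.ξ 0) (m - P.ξ 0) t ht.ne ht.add_ne
      ht.sub_ne a b s j j' s'
    simp only [sub_sub_sub_cancel_right] at yb
    have e₁ := Finset.sum_congr (rfl : (Finset.univ : Finset (Fin 2)) = _) fun a _ =>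
      Finset.sum_congr (rfl : (Finset.univ : Finset (Fin 2)) = _) fun b _ =>
        congrArg (fun z => (∑ c, P.R (l - P.ξ 0) t (a, s) (j, c) *
          P.R (m - P.ξ 0) (t + P.η * spinSign j) (b, c) (j', s')) * z) (ih' a b)
    have e₂ := Finset.sum_congr (rfl : (Finset.univ : Finset (Fin 2)) = _) fun a _ =>
      Finset.sum_congr (rfl : (Finset.univ : Finset (Fin 2)) = _) fun b _ =>
        congrArg (fun z => (P.tail.monodromyEntry 1 b m (t + P.η * spinSign s) *
          P.tail.monodromyEntry 1 a l (t + P.η * spinSign s + P.η * spinSign b)) h h' * z) (yb a b)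
    simp only [Fin.sum_univ_two] at e₁ e₂ ⊢
    linear_combination e₁ + e₂

/-! ### Spin conservation and special entries of C and D. -/

theorem weight_of_monodromyEntry_ne_zero {N : ℕ} (P : Params N) {l t : ℂ} {i j : Fin 2}
    {h h' : Spins N} (hne : P.monodromyEntry i j l t h h' ≠ 0) :
    (i : ℕ) + ∑ n, (h n : ℕ) = j + ∑ n, (h' n : ℕ) := by
  induction N generalizing t j with
  | zero =>
    rw [monodromyEntry_of_isEmpty] at hne
    simp_all
  | succ N ih =>
    obtain ⟨s, h, rfl⟩ : ∃ s g, h = Fin.cons s g := ⟨h 0, Fin.tail h, (Fin.cons_self_tail h).symm⟩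
    obtain ⟨s', h', rfl⟩ : ∃ s g, h' = Fin.cons s g :=
      ⟨h' 0, Fin.tail h', (Fin.cons_self_tail h').symm⟩
    rw [monodromyEntry_succ] at hne
    obtain ⟨k, -, hk⟩ := Finset.exists_ne_zero_of_sum_ne_zero hne
    have h₁ := ih P.tail (left_ne_zero_of_mul hk)
    have h₂ := P.weight_of_R_ne_zero (right_ne_zero_of_mul hk)
    simp only [Fin.sum_univ_succ, Fin.cons_zero, Fin.cons_succ]
    omega

theorem spins_eq_zero {N : ℕ} {h : Spins N} (hh : ∑ n, (h n : ℕ) = 0) : h = fun _ => 0 := by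
  funext n
  have := (Finset.sum_eq_zero_iff.1 hh) n (Finset.mem_univ n)
  exact Fin.ext this

theorem spins_eq_one {N : ℕ} {h : Spins N} (hh : ∑ n, (h n : ℕ) = N) : h = fun _ => 1 := by
  have hle : ∀ n ∈ Finset.univ, (h n : ℕ) ≤ 1 := fun n _ => by omega
  have := (Finset.sum_eq_sum_iff_of_le hle).1 (by simpa using hh)
  funext n
  exact Fin.ext (this n (Finset.mem_univ n))

theorem cons_const {N : ℕ} (s : Fin 2) :
    (fun _ => s : Spins (N + 1)) = Fin.cons s (fun _ : Fin N => s) := by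
  funext n
  refine Fin.cases ?_ (fun _ => ?_) n <;> simp

/-- The auxiliary spin stays down at each site, and the ratios θ(t - η)/θ(t) telescope along the
chain. -/
theorem monodromyEntry_one_one_up {N : ℕ} (P : Params N) {t : ℂ} (ht : P.Regular t) (l : ℂ) :
    P.monodromyEntry 1 1 l t (fun _ => 0) (fun _ => 0) =
      cexp (-(I * P.y * P.η)) ^ N * (∏ n, P.th (l - P.ξ n)) *
        (P.th (t - P.η) / P.th (t + ((N : ℂ) - 1) * P.η)) := by
  induction N generalizing t with
  | zero =>
    have := ht.sub_ne
    simp [monodromyEntry_of_isEmpty, sub_eq_add_neg] at this ⊢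
    field_simp
  | succ N ih =>
    have ih' := ih P.tail (ht.add_spinSign 0)
    rw [spinSign_zero, mul_one] at ih'
    simp only [tail_η, tail_y, tail_th, tail_ξ] at ih'
    rw [cons_const, monodromyEntry_succ, Fin.sum_univ_two, spinSign_zero, mul_one, ih',
      P.R_eq_zero (by decide), R_10_10, wb_neg, Fin.prod_univ_succ, add_sub_cancel_right,
      show t + P.η + ((N : ℂ) - 1) * P.η = t + (((N + 1 : ℕ) : ℂ) - 1) * P.η by push_cast; ring]
    have := ht.ne
    field_simp
    ring

theorem monodromyEntry_one_one_down {N : ℕ} (P : Params N) (l t : ℂ) :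
    P.monodromyEntry 1 1 l t (fun _ => 1) (fun _ => 1) = ∏ n, P.wa (l - P.ξ n) := by
  induction N generalizing t with
  | zero => simp [monodromyEntry_of_isEmpty]
  | succ N ih =>
    rw [cons_const, monodromyEntry_succ, Fin.sum_univ_two, P.R_eq_zero (by decide), R_11,
      ih P.tail, Fin.prod_univ_succ]
    simp only [tail_wa, tail_ξ]
    ring

theorem exists_cons_eq {N : ℕ} (h : Spins (N + 1)) : ∃ s g, h = Fin.cons s g :=
  ⟨h 0, Fin.tail h, (Fin.cons_self_tail h).symm⟩

/-- Through sites whose row spin is up, the auxiliary spin must remain down; at site `m` this costs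
the weight `b` at spectral parameter 0. -/
theorem monodromyEntry_one_one_eq_zero_of_left {N : ℕ} (P : Params N) (t : ℂ) (m : Fin N)
    {h : Spins N} (hh : ∀ k ≤ m, h k = 0) (g : Spins N) :
    P.monodromyEntry 1 1 (P.ξ m) t h g = 0 := by
  induction N generalizing t with
  | zero => exact m.elim0
  | succ N ih =>
    obtain ⟨s, h, rfl⟩ := exists_cons_eq h
    obtain ⟨s', g, rfl⟩ := exists_cons_eq g
    obtain rfl : s = 0 := hh 0 (Fin.zero_le _)
    rw [monodromyEntry_succ, Fin.sum_univ_two, P.R_eq_zero (i := 0) (by simp; omega), mul_zero,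
      zero_add]
    cases m using Fin.cases with
    | zero =>
      fin_cases s'
      · simp [R_10_10, wb, th_zero]
      · simp [P.R_eq_zero]
    | succ m =>
      have := ih P.tail (t + P.η * spinSign 0) m (h := h)
        (fun k hk => by simpa using hh k.succ (Fin.succ_le_succ_iff.2 hk)) g
      rw [tail_ξ] at this
      rw [this, zero_mul]

/-- Through sites whose column spin is down, the auxiliary spin must remain down; at site `m` this
costs `a(-η) = θ(0)`. -/
theorem monodromyEntry_one_one_eq_zero_of_right {N : ℕ} (P : Params N) (t : ℂ) (m : Fin N)
    (h : Spins N) {g : Spins N} (hg : ∀ k ≤ m, g k = 1) :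
    P.monodromyEntry 1 1 (P.ξ m - P.η) t h g = 0 := by
  induction N generalizing t with
  | zero => exact m.elim0
  | succ N ih =>
    obtain ⟨s, h, rfl⟩ := exists_cons_eq h
    obtain ⟨s', g, rfl⟩ := exists_cons_eq g
    obtain rfl : s' = 1 := hg 0 (Fin.zero_le _)
    rw [monodromyEntry_succ, Fin.sum_univ_two, P.R_eq_zero (i := 0) (by simp; omega), mul_zero,
      zero_add]
    cases m using Fin.cases with
    | zero =>
      fin_cases s
      · simp [P.R_eq_zero]
      · simp [R_11, wa, th_zero]
    | succ m =>
      have := ih P.tail (t + P.η * spinSign s) m h (g := g)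
        (fun k hk => by simpa using hg k.succ (Fin.succ_le_succ_iff.2 hk))
      rw [tail_ξ, tail_η] at this
      rw [this, zero_mul]

/-- The non-vanishing of the theta functions of `η` and of the differences of inhomogeneities. -/
structure Nondegenerate {N : ℕ} (P : Params N) : Prop where
  th_η : P.th P.η ≠ 0
  th_sub : ∀ a b, a ≠ b → P.th (P.ξ a - P.ξ b) ≠ 0
  th_sub_add : ∀ a b, a ≠ b → P.th (P.ξ a - P.ξ b + P.η) ≠ 0
  th_sub_sub : ∀ a b, a ≠ b → P.th (P.ξ a - P.ξ b - P.η) ≠ 0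

theorem Nondegenerate.tail {N : ℕ} {P : Params (N + 1)} (hP : P.Nondegenerate) :
    P.tail.Nondegenerate where
  th_η := hP.th_η
  th_sub a b hab := hP.th_sub _ _ (by simpa using hab)
  th_sub_add a b hab := hP.th_sub_add _ _ (by simpa using hab)
  th_sub_sub a b hab := hP.th_sub_sub _ _ (by simpa using hab)

theorem monodromyEntry_one_one_down_row {N : ℕ} (P : Params N) (l t : ℂ) {g : Spins N}
    (hg : g ≠ fun _ => 1) : P.monodromyEntry 1 1 l t (fun _ => 1) g = 0 := by
  by_contra hne
  have := P.weight_of_monodromyEntry_ne_zero hne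
  exact hg (spins_eq_one (by simpa using this.symm))

theorem monodromyEntry_one_one_up_col {N : ℕ} (P : Params N) (l t : ℂ) {h : Spins N}
    (hh : h ≠ fun _ => 0) : P.monodromyEntry 1 1 l t h (fun _ => 0) = 0 := by
  by_contra hne
  have := P.weight_of_monodromyEntry_ne_zero hne
  exact hh (spins_eq_zero (by simpa using this))

theorem monodromyEntry_one_one_up_row {N : ℕ} (P : Params N) (l t : ℂ) {g : Spins N}
    (hg : g ≠ fun _ => 0) : P.monodromyEntry 1 1 l t (fun _ => 0) g = 0 := by
  by_contra hne
  have := P.weight_of_monodromyEntry_ne_zero hne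
  exact hg (spins_eq_zero (by simpa using this.symm))

theorem monodromyEntry_one_one_down_col {N : ℕ} (P : Params N) (l t : ℂ) {h : Spins N}
    (hh : h ≠ fun _ => 1) : P.monodromyEntry 1 1 l t h (fun _ => 1) = 0 := by
  by_contra hne
  have := P.weight_of_monodromyEntry_ne_zero hne
  exact hh (spins_eq_one (by simpa using this))

/-- The spins at the sites up to `m` (excluded) are `s`, the others are `s'`. -/
def domainWall {N : ℕ} (s s' : Fin 2) (m : ℕ) : Spins N := fun k => if (k : ℕ) < m then s else s'

theorem domainWall_zero {N : ℕ} (s s' : Fin 2) : (domainWall s s' 0 : Spins N) = fun _ => s' := by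
  funext k
  simp [domainWall]

theorem domainWall_succ {N : ℕ} (s s' : Fin 2) (m : ℕ) :
    (domainWall s s' (m + 1) : Spins (N + 1)) = Fin.cons s (domainWall s s' m) := by
  funext k
  cases k using Fin.cases <;> simp [domainWall]

/-- In the row of `C(ξ_m)` indexed by `|0, …, 0, 1, …, 1⟩`, only one entry does not vanish. -/
theorem monodromyEntry_one_zero_row {N : ℕ} {P : Params N} (hP : P.Nondegenerate) {t : ℂ}
    (ht : P.Regular t) (m : Fin N) (g : Spins N) :
    P.monodromyEntry 1 0 (P.ξ m) t (domainWall 0 1 (m + 1)) g ≠ 0 ↔ g = domainWall 0 1 m := by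
  induction N generalizing t with
  | zero => exact m.elim0
  | succ N ih =>
    obtain ⟨s', g, rfl⟩ := exists_cons_eq g
    rw [domainWall_succ, monodromyEntry_succ, Fin.sum_univ_two]
    cases m using Fin.cases with
    | zero =>
      -- A nonzero entry would need `N + 1` down spins on the `N` remaining sites.
      have h0 : P.tail.monodromyEntry 1 0 (P.ξ 0) (t + P.η * spinSign 0)
          (fun _ => 1) g = 0 := by
        by_contra hne
        have h₁ := P.tail.weight_of_monodromyEntry_ne_zero hne
        have h₂ : ∑ n, (g n : ℕ) ≤ ∑ n : Fin N, 1 := Finset.sum_le_sum fun n _ => by omega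
        simp at h₁ h₂
        omega
      simp only [Fin.val_zero, domainWall_zero, h0, zero_mul, zero_add, cons_const, Fin.cons_inj,
        sub_self]
      by_cases hg : g = fun _ => 1
      · subst hg
        fin_cases s'
        · simp [P.R_eq_zero]
        · simp only [monodromyEntry_one_one_down, Fin.mk_one, R_10_01, wc_neg, sub_zero, and_self,
            iff_true]
          refine mul_ne_zero (Finset.prod_ne_zero_iff.2 fun n _ => ?_)
            (mul_ne_zero (Complex.exp_ne_zero _)
              (div_ne_zero (mul_ne_zero hP.th_η ht.ne) ht.ne))
          exact hP.th_sub_add _ _ (Fin.succ_ne_zero n).symm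
      · simp [P.tail.monodromyEntry_one_one_down_row _ _ hg, hg]
    | succ m =>
      -- The path with auxiliary spin down after the first site dies here; the other path has weight
      -- `a(ξ_m - ξ_0)` and leaves the first spin up.
      have h1 := P.tail.monodromyEntry_one_one_eq_zero_of_left (t + P.η * spinSign 0) m
        (h := domainWall 0 1 (m + 1)) (fun k hk => by
          have : (k : ℕ) < m + 1 := by have : (k : ℕ) ≤ m := hk; omega
          simp [domainWall, this]) g
      have ih' := ih hP.tail (t := t + P.η * spinSign 0) (ht.add_spinSign 0) m g
      rw [tail_ξ] at h1 ih'
      rw [Fin.val_succ, h1, zero_mul, add_zero, domainWall_succ, Fin.cons_inj, mul_ne_zero_iff, ih']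
      fin_cases s'
      · have := hP.th_sub_add m.succ 0 (Fin.succ_ne_zero m)
        simp [R_00, wa, this]
      · simp [P.R_eq_zero]

/-- In the column of `C(ξ_m - η)` indexed by `|1, …, 1, 0, …, 0⟩`, only one entry does not
vanish. -/
theorem monodromyEntry_one_zero_col {N : ℕ} {P : Params N} (hP : P.Nondegenerate) {t : ℂ}
    (ht : P.Regular t) (m : Fin N) (h : Spins N) :
    P.monodromyEntry 1 0 (P.ξ m - P.η) t h (domainWall 1 0 (m + 1)) ≠ 0 ↔
      h = domainWall 1 0 m := by
  induction N generalizing t with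
  | zero => exact m.elim0
  | succ N ih =>
    obtain ⟨s, h, rfl⟩ := exists_cons_eq h
    rw [domainWall_succ, monodromyEntry_succ, Fin.sum_univ_two]
    cases m using Fin.cases with
    | zero =>
      have h0 : P.tail.monodromyEntry 1 0 (P.ξ 0 - P.η) (t + P.η * spinSign s)
          h (fun _ => 0) = 0 := by
        by_contra hne
        have h₁ := P.tail.weight_of_monodromyEntry_ne_zero hne
        simp at h₁
      simp only [Fin.val_zero, domainWall_zero, h0, zero_mul, zero_add, cons_const, Fin.cons_inj]
      by_cases hh : h = fun _ => 0
      · subst hh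
        fin_cases s
        · have hR := ht.add_spinSign 0
          simp only [Fin.zero_eta, P.tail.monodromyEntry_one_one_up (t := t + P.η * spinSign 0) hR,
            R_10_01, wc_neg, and_self, iff_true]
          have h1 : P.th (t - (P.ξ 0 - P.η - P.ξ 0)) ≠ 0 := by
            convert ht.add_ne using 2; ring
          refine mul_ne_zero (mul_ne_zero (mul_ne_zero (pow_ne_zero _ (Complex.exp_ne_zero _))
            (Finset.prod_ne_zero_iff.2 fun n _ => ?_)) (div_ne_zero hR.sub_ne ?_))
            (mul_ne_zero (Complex.exp_ne_zero _) (div_ne_zero (mul_ne_zero hP.th_η h1) ht.ne))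
          · have := hP.th_sub_sub 0 n.succ (Fin.succ_ne_zero n).symm
            rw [tail_th, tail_ξ]
            convert this using 2; ring
          · simpa [tail_th, tail_η] using hR ((N : ℤ) - 1)
        · simp [P.R_eq_zero]
      · simp [P.tail.monodromyEntry_one_one_up_col _ _ hh, hh]
    | succ m =>
      have h1 := P.tail.monodromyEntry_one_one_eq_zero_of_right (t + P.η * spinSign s) m h
        (g := domainWall 1 0 (m + 1)) (fun k hk => by
          have : (k : ℕ) < m + 1 := by have : (k : ℕ) ≤ m := hk; omega
          simp [domainWall, this])
      have ih' := ih hP.tail (t := t + P.η * spinSign s) (ht.add_spinSign s) m h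
      rw [tail_ξ, tail_η] at h1 ih'
      rw [Fin.val_succ, h1, zero_mul, add_zero, domainWall_succ, Fin.cons_inj, mul_ne_zero_iff, ih']
      fin_cases s
      · simp [P.R_eq_zero]
      · have h2 := hP.th_sub_sub m.succ 0 (Fin.succ_ne_zero m)
        have h3 : P.th (P.ξ m.succ - P.η - P.ξ 0) ≠ 0 := by convert h2 using 2; ring
        simp [R_01_01, wb, h3, ht.ne, ht.add_ne]

end Params

/-! ### The operators `𝒞`, `𝒟` on the dynamical space. -/

theorem shiftOp_basisKet {N : ℕ} (k : ℤ) (h : Spins N) (a : ℤ) :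
    shiftOp N k (basisKet h a) = basisKet h (a + k) := by
  simp [shiftOp, basisKet]

theorem spinOp_basisKet {N : ℕ} (h : Spins N) (a : ℤ) :
    spinOp N (basisKet h a) = (spinSum h : ℂ) • basisKet h a := by
  simp [spinOp, basisKet]

theorem ket_hom_ext {N : ℕ} {M : Type*} [AddCommMonoid M] [Module ℂ M] {f g : Ket N →ₗ[ℂ] M}
    (h : ∀ g' a, f (basisKet g' a) = g (basisKet g' a)) : f = g :=
  Finsupp.lhom_ext' fun p => LinearMap.ext_ring (h p.1 p.2)

theorem basisBra_basisKet {N : ℕ} (h g : Spins N) (a b : ℤ) :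
    basisBra h a (basisKet g b) = if g = h ∧ b = a then 1 else 0 := by
  simp [basisBra, basisKet, Finsupp.single_apply, Prod.ext_iff]

theorem spinSum_eq {N : ℕ} (h : Spins N) :
    (spinSum h : ℤ) = N - 2 * ∑ n, ((h n : ℕ) : ℤ) := by
  simp [spinSum, Finset.sum_sub_distrib, Finset.mul_sum]

namespace Params

variable {N : ℕ} (P : Params N)

theorem atTau_basisKet (F : ℂ → Matrix (Spins N) (Spins N) ℂ) (h : Spins N) (a : ℤ) :
    P.atTau F (basisKet h a) = ∑ g, F (P.tEig a) g h • basisKet g a := by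
  simp [atTau, basisKet]

theorem tau_basisKet (h : Spins N) (a : ℤ) :
    P.tau (basisKet h a) = P.tEig a • basisKet h a := by
  simp [tau, basisKet]

theorem tEig_add (a k : ℤ) : P.tEig (a + k) = P.tEig a - k * P.η := by
  simp only [tEig]
  push_cast
  ring

theorem opC_basisKet (l : ℂ) (h : Spins N) (a : ℤ) :
    P.opC l (basisKet h a) =
      ∑ g, P.monodromyEntry 1 0 l (P.tEig (a + 1)) g h • basisKet g (a + 1) := by
  simp only [opC, Module.End.mul_apply, shiftOp_basisKet, atTau_basisKet]

theorem opD_basisKet (l : ℂ) (h : Spins N) (a : ℤ) :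
    P.opD l (basisKet h a) =
      ∑ g, P.monodromyEntry 1 1 l (P.tEig (a - 1)) g h • basisKet g (a - 1) := by
  simp only [opD, Module.End.mul_apply, shiftOp_basisKet, atTau_basisKet, sub_eq_add_neg]

theorem sum_smul_sum_smul (A B : Matrix (Spins N) (Spins N) ℂ) (h : Spins N)
    (v : Spins N → Ket N) :
    ∑ g, B g h • ∑ g', A g' g • v g' = ∑ g', (A * B) g' h • v g' := by
  simp only [Matrix.mul_apply, Finset.smul_sum, Finset.sum_smul, smul_smul]
  rw [Finset.sum_comm]
  simp only [mul_comm]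

/-- The shift of `τ` evaluates the inner factor at `t(a + 1) = t(a + 2) + η`, which is the shifted
argument in `rtt_row`. -/
theorem opC_opC_basisKet (l m : ℂ) (h : Spins N) (a : ℤ) :
    P.opC l (P.opC m (basisKet h a)) = ∑ g,
      (P.monodromyEntry 1 0 l (P.tEig (a + 2)) *
        P.monodromyEntry 1 0 m (P.tEig (a + 2) + P.η)) g h • basisKet g (a + 2) := by
  rw [opC_basisKet, map_sum]
  simp only [map_smul, opC_basisKet, add_assoc, one_add_one_eq_two]
  rw [sum_smul_sum_smul, show P.tEig (a + 2) + P.η = P.tEig (a + 1) by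
    rw [tEig_add, tEig_add]; push_cast; ring]

theorem opC_opD_basisKet (l m : ℂ) (h : Spins N) (a : ℤ) :
    P.opC l (P.opD m (basisKet h a)) = ∑ g,
      (P.monodromyEntry 1 0 l (P.tEig a) *
        P.monodromyEntry 1 1 m (P.tEig a + P.η)) g h • basisKet g a := by
  rw [opD_basisKet, map_sum]
  simp only [map_smul, opC_basisKet, sub_add_cancel]
  rw [sum_smul_sum_smul, show P.tEig a + P.η = P.tEig (a - 1) by
    rw [sub_eq_add_neg, tEig_add]; push_cast; ring]

theorem opD_opC_basisKet (l m : ℂ) (h : Spins N) (a : ℤ) :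
    P.opD l (P.opC m (basisKet h a)) = ∑ g,
      (P.monodromyEntry 1 1 l (P.tEig a) *
        P.monodromyEntry 1 0 m (P.tEig a - P.η)) g h • basisKet g a := by
  rw [opC_basisKet, map_sum]
  simp only [map_smul, opD_basisKet, add_sub_cancel_right]
  rw [sum_smul_sum_smul, show P.tEig a - P.η = P.tEig (a + 1) by
    rw [tEig_add]; push_cast; ring]

theorem commute_opC (hω : 0 < P.ω.im) (ht : ∀ a, P.Regular (P.tEig a)) {l m : ℂ}
    (hlm : P.th (l - m + P.η) ≠ 0) : Commute (P.opC l) (P.opC m) := by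
  refine ket_hom_ext fun h a => ?_
  rw [Module.End.mul_apply, Module.End.mul_apply, opC_opC_basisKet, opC_opC_basisKet]
  have key := P.rtt_row hω (ht (a + 2)) l m 0 0
  simp only [Fin.sum_univ_two, spinSign_zero, mul_one, R_00,
    P.R_eq_zero (i := 0) (j := 1) (i' := 0) (j' := 0) (by decide),
    P.R_eq_zero (i := 1) (j := 0) (i' := 0) (j' := 0) (by decide),
    P.R_eq_zero (i := 1) (j := 1) (i' := 0) (j' := 0) (by decide), zero_smul, add_zero] at key
  have hwa : P.wa (l - m) ≠ 0 := hlm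
  rw [smul_right_injective _ hwa key]

/-- Used under bras at `m = ξ_n`, where the first term on the right vanishes. -/
theorem opC_opD_left (hω : 0 < P.ω.im) (ht : ∀ a, P.Regular (P.tEig a)) (l m : ℂ) (h : Spins N)
    (a : ℤ) :
    P.wa (l - m) • P.opD l (P.opC m (basisKet h a)) =
      P.R (l - m) (P.tEig a) (0, 1) (1, 0) • P.opD m (P.opC l (basisKet h a)) +
      P.R (l - m) (P.tEig a) (1, 0) (1, 0) • P.opC m (P.opD l (basisKet h a)) := by
  have key := P.rtt_row hω (ht a) l m 1 0
  simp only [Fin.sum_univ_two, spinSign_zero, spinSign_one, mul_one, mul_neg, ← sub_eq_add_neg,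
    P.R_eq_zero (i := 0) (j := 0) (i' := 1) (j' := 0) (by decide),
    P.R_eq_zero (i := 1) (j := 1) (i' := 1) (j' := 0) (by decide), zero_smul, add_zero,
    zero_add] at key
  simp only [opD_opC_basisKet, opC_opD_basisKet, Finset.smul_sum, smul_smul,
    ← Finset.sum_add_distrib, ← add_smul]
  refine Finset.sum_congr rfl fun g _ => ?_
  congr 1
  exact congrFun (congrFun key g) h

/-- Used on kets at `ξ_n - η` in place of `l`, where the last term vanishes. -/
theorem opC_opD_right (hω : 0 < P.ω.im) (ht : ∀ a, P.Regular (P.tEig a)) (l m : ℂ) (h : Spins N)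
    (a : ℤ) :
    P.wa (l - m) • P.opC l (P.opD m (basisKet h a)) =
      P.R (l - m) (P.tEig a) (0, 1) (0, 1) • P.opD m (P.opC l (basisKet h a)) +
      P.R (l - m) (P.tEig a) (1, 0) (0, 1) • P.opC m (P.opD l (basisKet h a)) := by
  have key := P.rtt_row hω (ht a) l m 0 1
  simp only [Fin.sum_univ_two, spinSign_zero, spinSign_one, mul_one, mul_neg, ← sub_eq_add_neg,
    P.R_eq_zero (i := 0) (j := 0) (i' := 0) (j' := 1) (by decide),
    P.R_eq_zero (i := 1) (j := 1) (i' := 0) (j' := 1) (by decide), zero_smul, add_zero,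
    zero_add] at key
  simp only [opD_opC_basisKet, opC_opD_basisKet, Finset.smul_sum, smul_smul,
    ← Finset.sum_add_distrib, ← add_smul]
  refine Finset.sum_congr rfl fun g _ => ?_
  congr 1
  exact congrFun (congrFun key g) h

end Params

/-! ### Ordered products and induction on spin configurations. -/

theorem commute_prod_ofFn {M : Type*} [Monoid M] {N : ℕ} {f : Fin N → M} {x : M}
    (h : ∀ n, Commute x (f n)) : Commute x (List.ofFn f).prod := by
  refine Commute.list_prod_right _ _ fun y hy => ?_
  obtain ⟨n, rfl⟩ := (List.mem_ofFn' _ _).1 hy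
  exact h n

theorem prod_ofFn_update {M : Type*} [Monoid M] {N : ℕ} (f : Fin N → M) (n : Fin N) {x : M}
    (h : ∀ n, Commute x (f n)) (hn : f n = 1) :
    (List.ofFn (Function.update f n x)).prod = (List.ofFn f).prod * x := by
  induction N with
  | zero => exact n.elim0
  | succ N ih =>
    rw [List.ofFn_succ, List.ofFn_succ, List.prod_cons, List.prod_cons]
    have hc := commute_prod_ofFn fun k : Fin N => h k.succ
    cases n using Fin.cases with
    | zero =>
      have : (fun k : Fin N => Function.update f 0 x k.succ) = fun k => f k.succ := by
        funext k
        simp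
      rw [this, Function.update_self, hn, one_mul, hc.eq]
    | succ n =>
      have : (fun k : Fin N => Function.update f n.succ x k.succ) =
          Function.update (fun k => f k.succ) n x := by
        funext k
        by_cases hk : k = n
        · subst hk; simp
        · simp [hk]
      rw [this, ih _ n (fun k => h k.succ) hn, Function.update_of_ne (Fin.succ_ne_zero n).symm,
        mul_assoc]

theorem sum_update_one {N : ℕ} {h : Spins N} {n : Fin N} (hn : h n = 0) :
    ∑ k, (Function.update h n 1 k : ℕ) = (∑ k, (h k : ℕ)) + 1 := by
  have : (fun k => (Function.update h n 1 k : ℕ)) = Function.update (fun k => (h k : ℕ)) n 1 := by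
    funext k
    by_cases hk : k = n
    · subst hk; simp
    · simp [hk]
  rw [this, Finset.sum_update_of_mem (Finset.mem_univ n),
    ← Finset.add_sum_erase _ _ (Finset.mem_univ n), hn, Finset.sdiff_singleton_eq_erase]
  simp [add_comm]

theorem update_one_update_zero {N : ℕ} {h : Spins N} {n : Fin N} (hn : h n = 0) :
    Function.update (Function.update h n 1) n 0 = h := by
  rw [Function.update_idem, ← hn, Function.update_eq_self]

theorem update_zero_update_one {N : ℕ} {h : Spins N} {n : Fin N} (hn : h n = 1) :
    Function.update (Function.update h n 0) n 1 = h := by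
  rw [Function.update_idem, ← hn, Function.update_eq_self]

theorem eq_zero_or_eq_one (i : Fin 2) : i = 0 ∨ i = 1 := by omega

theorem spins_induction_up {N : ℕ} {p : Spins N → Prop} (h0 : p fun _ => 0)
    (step : ∀ h n, h n = 0 → p h → p (Function.update h n 1)) (h : Spins N) : p h := by
  induction hw : ∑ k, (h k : ℕ) generalizing h with
  | zero => rwa [Params.spins_eq_zero hw]
  | succ w ih =>
    obtain ⟨n, hn⟩ : ∃ n, h n = 1 := by
      by_contra! hne
      have : ∀ n, h n = 0 := fun n => (eq_zero_or_eq_one (h n)).resolve_right (hne n)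
      simp [this] at hw
    rw [← update_zero_update_one hn]
    refine step _ n (by simp) (ih _ ?_)
    have := sum_update_one (h := Function.update h n 0) (n := n) (by simp)
    rw [update_zero_update_one hn] at this
    omega

theorem spins_induction_down {N : ℕ} {p : Spins N → Prop} (h1 : p fun _ => 1)
    (step : ∀ h n, h n = 1 → p h → p (Function.update h n 0)) (h : Spins N) : p h := by
  have key := spins_induction_up (p := fun h => p fun k => 1 - h k) (by simpa using h1)
    (fun h n hn hp => by
      have := step _ n (by simp [hn]) hp
      convert this using 2 with k
      by_cases hk : k = n
      · subst hk; simp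
      · simp [hk]) (fun k => 1 - h k)
  simpa using key

/-! ### The states: recursion, support, and recursion of the coefficients. -/

namespace Params

variable {N : ℕ} {P : Params N}

theorem fd_sub_ne_zero (hP : P.Nondegenerate) (n : Fin N) : P.fd (P.ξ n - P.η) ≠ 0 := by
  unfold fd fa
  refine Finset.prod_ne_zero_iff.2 fun m _ => ?_
  simp only [wa]
  by_cases hnm : n = m
  · subst hnm
    rw [show P.ξ n - P.η - P.η - P.ξ n + P.η = -P.η by ring, P.th_neg]
    exact neg_ne_zero.2 hP.th_η
  · convert hP.th_sub_sub n m hnm using 2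
    ring

/-- Since the `𝒞(ξ_k)` commute, the new factor can be moved to the far right, which makes induction
on flipped spins possible. -/
theorem bra_update (hω : 0 < P.ω.im) (hP : P.Nondegenerate) (ht : ∀ a, P.Regular (P.tEig a))
    (c : ℂ) (r : ℤ) {h : Spins N} {n : Fin N} (hn : h n = 0) :
    P.bra c r (Function.update h n 1) =
      P.bra c r h ∘ₗ ((P.fd (P.ξ n - P.η))⁻¹ • P.opC (P.ξ n)) := by
  have hf : (fun k => ((P.fd (P.ξ k - P.η))⁻¹ • P.opC (P.ξ k)) ^
      (Function.update h n 1 k : ℕ)) = Function.update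
        (fun k => ((P.fd (P.ξ k - P.η))⁻¹ • P.opC (P.ξ k)) ^ (h k : ℕ)) n
        ((P.fd (P.ξ n - P.η))⁻¹ • P.opC (P.ξ n)) := by
    funext k
    by_cases hk : k = n
    · subst hk; simp
    · simp [hk]
  rw [bra, hf, prod_ofFn_update _ _ _ (by simp [hn])]
  · rfl
  · intro k
    by_cases hk : n = k
    · subst hk
      exact Commute.self_pow _ _
    · exact (((commute_opC P hω ht (hP.th_sub_add _ _ hk)).smul_left _).smul_right _).pow_right _

theorem ket_update (hω : 0 < P.ω.im) (hP : P.Nondegenerate) (ht : ∀ a, P.Regular (P.tEig a))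
    (c : ℂ) (r : ℤ) {h : Spins N} {n : Fin N} (hn : h n = 1) :
    P.ket c r (Function.update h n 0) =
      (P.fd (P.ξ n - P.η))⁻¹ • P.opC (P.ξ n - P.η) (P.ket c r h) := by
  have hf : (fun k => ((P.fd (P.ξ k - P.η))⁻¹ • P.opC (P.ξ k - P.η)) ^
      (1 - (Function.update h n 0 k : ℕ))) = Function.update
        (fun k => ((P.fd (P.ξ k - P.η))⁻¹ • P.opC (P.ξ k - P.η)) ^ (1 - (h k : ℕ))) n
        ((P.fd (P.ξ n - P.η))⁻¹ • P.opC (P.ξ n - P.η)) := by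
    funext k
    by_cases hk : k = n
    · subst hk; simp
    · simp [hk]
  have hc : ∀ k, Commute ((P.fd (P.ξ n - P.η))⁻¹ • P.opC (P.ξ n - P.η))
      (((P.fd (P.ξ k - P.η))⁻¹ • P.opC (P.ξ k - P.η)) ^ (1 - (h k : ℕ))) := by
    intro k
    by_cases hk : n = k
    · subst hk
      exact Commute.self_pow _ _
    · refine (((commute_opC P hω ht ?_).smul_left _).smul_right _).pow_right _
      rw [sub_sub_sub_cancel_right]
      exact hP.th_sub_add _ _ hk
  rw [ket, hf, prod_ofFn_update _ _ hc (by simp [hn]), ← (commute_prod_ofFn hc).eq]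
  rfl

theorem bra_zero (c : ℂ) (r : ℤ) : P.bra c r (fun _ => 0) = braRef N c r := by
  have : (List.ofFn fun _ : Fin N => (1 : Module.End ℂ (Ket N))).prod = 1 := by simp
  simp only [bra, Fin.val_zero, pow_zero, this]
  rfl

theorem ket_one (c : ℂ) (r : ℤ) : P.ket c r (fun _ => 1) = ketRef N c r := by
  have : (List.ofFn fun _ : Fin N => (1 : Module.End ℂ (Ket N))).prod = 1 := by simp
  simp only [ket, Fin.val_one, Nat.sub_self, pow_zero, this]
  rfl

theorem tIndex_eq (r : ℤ) (h : Spins N) : tIndex r h = -r - ((∑ k, (h k : ℕ) : ℕ) : ℤ) := by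
  simp [tIndex]

/-- Each factor `𝒞` lowers `a` by one and adds a down spin. With `a` fixed, the `τ`-dependent
exchange coefficients become numbers on the state. -/
theorem bra_support (hω : 0 < P.ω.im) (hP : P.Nondegenerate) (ht : ∀ a, P.Regular (P.tEig a))
    (c : ℂ) (r : ℤ) (h g : Spins N) (a : ℤ) (hne : P.bra c r h (basisKet g a) ≠ 0) :
    a = tIndex r h ∧ ∑ k, (g k : ℕ) = ∑ k, (h k : ℕ) := by
  induction h using spins_induction_up generalizing g a with
  | h0 =>
    rw [bra_zero, braRef, LinearMap.smul_apply, basisBra_basisKet] at hne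
    split_ifs at hne with h0
    · rw [h0.1]
      exact ⟨h0.2, rfl⟩
    · simp at hne
  | step h n hn ih =>
    rw [bra_update hω hP ht c r hn, LinearMap.comp_apply, LinearMap.smul_apply, map_smul,
      opC_basisKet, map_sum] at hne
    obtain ⟨g', -, hg'⟩ := Finset.exists_ne_zero_of_sum_ne_zero (right_ne_zero_of_smul hne)
    rw [map_smul] at hg'
    obtain ⟨h₁, h₂⟩ := ih g' (a + 1) (right_ne_zero_of_smul hg')
    have h₃ := P.weight_of_monodromyEntry_ne_zero (left_ne_zero_of_smul hg')
    rw [tIndex_eq, sum_update_one hn] at *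
    simp only [Fin.val_one, Fin.val_zero] at h₃
    omega

/-- The span of the basis vectors `|g⟩ ⊗ |t(a)⟩` with `w` spins down. -/
def weightSpace (N : ℕ) (a : ℤ) (w : ℕ) : Submodule ℂ (Ket N) :=
  Submodule.span ℂ {v | ∃ g : Spins N, ∑ k, (g k : ℕ) = w ∧ v = basisKet g a}

theorem opC_mem_weightSpace (l : ℂ) {a : ℤ} {w : ℕ} {v : Ket N}
    (hv : v ∈ weightSpace N a (w + 1)) : P.opC l v ∈ weightSpace N (a + 1) w := by
  have : weightSpace N a (w + 1) ≤ (weightSpace N (a + 1) w).comap (P.opC l) := by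
    refine Submodule.span_le.2 ?_
    rintro _ ⟨g, hg, rfl⟩
    rw [SetLike.mem_coe, Submodule.mem_comap, opC_basisKet]
    refine Submodule.sum_mem _ fun g' _ => ?_
    by_cases h0 : P.monodromyEntry 1 0 l (P.tEig (a + 1)) g' g = 0
    · simp [h0]
    · have := P.weight_of_monodromyEntry_ne_zero h0
      simp only [Fin.val_one, Fin.val_zero] at this
      exact Submodule.smul_mem _ _ (Submodule.subset_span ⟨g', by omega, rfl⟩)
  exact this hv

theorem ket_mem_weightSpace (hω : 0 < P.ω.im) (hP : P.Nondegenerate)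
    (ht : ∀ a, P.Regular (P.tEig a)) (c : ℂ) (r : ℤ) (h : Spins N) :
    P.ket c r h ∈ weightSpace N (tIndex r h) (∑ k, (h k : ℕ)) := by
  induction h using spins_induction_down with
  | h1 =>
    rw [ket_one, ketRef]
    refine Submodule.smul_mem _ _ (Submodule.subset_span ⟨_, rfl, rfl⟩)
  | step h n hn ih =>
    rw [ket_update hω hP ht c r hn]
    have := sum_update_one (h := Function.update h n 0) (n := n) (by simp)
    rw [update_zero_update_one hn] at this
    rw [this] at ih
    have h₂ := P.opC_mem_weightSpace (P.ξ n - P.η) ih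
    rw [tIndex_eq, this, Nat.cast_add, Nat.cast_one, sub_add_eq_sub_sub, sub_add_cancel,
      ← tIndex_eq] at h₂
    exact Submodule.smul_mem _ _ h₂

theorem th_tVal_ne_zero (ht : ∀ a, P.Regular (P.tEig a)) (r : ℤ) (h : Spins N) :
    P.th (P.tVal r h) ≠ 0 := by
  rw [← tEig_tIndex]
  exact (ht _).ne

theorem dCoeff_eq_zero_iff (ht : ∀ a, P.Regular (P.tEig a)) (r : ℤ) (h : Spins N) (l : ℂ) :
    P.dCoeff r h l = 0 ↔ ∃ n, P.th (l - (P.ξ n - P.η * ((h n : ℕ) : ℂ))) = 0 := by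
  simp [dCoeff, th_tVal_ne_zero ht, Complex.exp_ne_zero, Finset.prod_eq_zero_iff]

theorem tVal_update (r : ℤ) {h : Spins N} {n : Fin N} (hn : h n = 0) :
    P.tVal r (Function.update h n 1) = P.tVal r h + P.η := by
  rw [← tEig_tIndex, ← tEig_tIndex, tIndex_eq, tIndex_eq, sum_update_one hn]
  simp only [tEig]
  push_cast
  ring

theorem prod_th_update (l : ℂ) {h : Spins N} {n : Fin N} (hn : h n = 0) :
    (∏ k, P.th (l - (P.ξ k - P.η * ((Function.update h n 1 k : ℕ) : ℂ)))) * P.th (l - P.ξ n) =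
      (∏ k, P.th (l - (P.ξ k - P.η * ((h k : ℕ) : ℂ)))) * P.th (l - P.ξ n + P.η) := by
  rw [← Finset.mul_prod_erase _ _ (Finset.mem_univ n),
    ← Finset.mul_prod_erase Finset.univ (fun k => P.th (l - (P.ξ k - P.η * ((h k : ℕ) : ℂ))))
      (Finset.mem_univ n)]
  have : ∏ k ∈ Finset.univ.erase n,
        P.th (l - (P.ξ k - P.η * ((Function.update h n 1 k : ℕ) : ℂ))) =
      ∏ k ∈ Finset.univ.erase n, P.th (l - (P.ξ k - P.η * ((h k : ℕ) : ℂ))) :=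
    Finset.prod_congr rfl fun k hk => by rw [Function.update_of_ne (Finset.ne_of_mem_erase hk)]
  rw [this, Function.update_self, hn]
  simp only [Fin.val_one, Fin.val_zero, Nat.cast_one, Nat.cast_zero, mul_one, mul_zero, sub_zero]
  rw [show l - (P.ξ n - P.η) = l - P.ξ n + P.η by ring]
  ring

theorem exp_spinSum_update (z : ℂ) {h : Spins N} {n : Fin N} (hn : h n = 0) (b : ℂ) :
    cexp (-(z * (((spinSum (Function.update h n 1) : ℂ) - b) / 2))) =
      cexp (-(z * (((spinSum h : ℂ) - b) / 2))) * cexp z := by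
  rw [← Complex.exp_add]
  congr 1
  have : (spinSum (Function.update h n 1) : ℂ) = spinSum h - 2 := by
    have := sum_update_one hn
    have h2 : spinSum (Function.update h n 1) = spinSum h - 2 := by
      rw [spinSum_eq, spinSum_eq]
      zify at this
      rw [this]
      ring
    rw [h2]
    push_cast
    ring
  rw [this]
  ring

/-- The ratio of neighbouring coefficients is that of the `a` and `b` weights in the direct exchange
term; the exponential and the theta quotient in the coefficient account for the dynamical part of
`b`. -/
theorem dCoeff_update_left (ht : ∀ a, P.Regular (P.tEig a)) (r : ℤ) (l : ℂ) {h : Spins N}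
    {n : Fin N} (hn : h n = 0) :
    P.wa (l - P.ξ n) * P.dCoeff r h l =
      P.R (l - P.ξ n) (P.tVal r (Function.update h n 1)) (1, 0) (1, 0) *
        P.dCoeff r (Function.update h n 1) l := by
  have h1 := th_tVal_ne_zero ht r fun _ => 1
  have h2 := th_tVal_ne_zero ht r (Function.update h n 1)
  rw [tVal_update r hn] at h2
  rw [R_10_10, wb_neg, dCoeff, dCoeff, exp_spinSum_update _ hn, tVal_update r hn,
    add_sub_cancel_right, wa, Complex.exp_neg (I * P.y * P.η)]
  have := Complex.exp_ne_zero (I * P.y * P.η)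
  field_simp
  linear_combination -P.th (P.tVal r h) * P.prod_th_update l hn

theorem dCoeff_update_right (ht : ∀ a, P.Regular (P.tEig a)) (r : ℤ) (l : ℂ) {h : Spins N}
    {n : Fin N} (hn : h n = 0) :
    P.wa (P.ξ n - P.η - l) * P.dCoeff r (Function.update h n 1) l =
      P.R (P.ξ n - P.η - l) (P.tVal r h) (0, 1) (0, 1) * P.dCoeff r h l := by
  have h1 := th_tVal_ne_zero ht r fun _ => 1
  have h2 := th_tVal_ne_zero ht r h
  rw [R_01_01, wb, dCoeff, dCoeff, exp_spinSum_update _ hn, tVal_update r hn, wa,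
    show P.ξ n - P.η - l + P.η = -(l - P.ξ n) by ring,
    show P.ξ n - P.η - l = -(l - P.ξ n + P.η) by ring, P.th_neg, P.th_neg]
  field_simp
  linear_combination -P.th (P.tVal r h + P.η) * P.prod_th_update l hn

end Params

/-! ### The action of `𝒟` on the states. -/

namespace Params

variable {N : ℕ} {P : Params N}

theorem continuous_th (hω : 0 < P.ω.im) : Continuous P.th := (differentiable_theta hω).continuous

theorem continuous_R (hω : 0 < P.ω.im) (t : ℂ) (p q : Fin 2 × Fin 2) :
    Continuous fun l => P.R l t p q := by
  have := P.continuous_th hω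
  obtain ⟨i, j⟩ := p
  obtain ⟨i', j'⟩ := q
  fin_cases i <;> fin_cases j <;> fin_cases i' <;> fin_cases j' <;>
    simp [R, wa, wb, wc] <;> fun_prop

theorem continuous_monodromyEntry (hω : 0 < P.ω.im) (t : ℂ) (i j : Fin 2) (h h' : Spins N) :
    Continuous fun l => P.monodromyEntry i j l t h h' := by
  induction N generalizing t j with
  | zero =>
    simp only [monodromyEntry_of_isEmpty]
    exact continuous_const
  | succ N ih =>
    obtain ⟨s, h, rfl⟩ := exists_cons_eq h
    obtain ⟨s', h', rfl⟩ := exists_cons_eq h'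
    simp only [monodromyEntry_succ]
    refine continuous_finsetSum _ fun k _ => (ih (P := P.tail) hω _ _ h h').mul ?_
    exact (P.continuous_R hω t (k, s) (j, s')).comp (continuous_sub_right (P.ξ 0))

theorem continuous_opD (hω : 0 < P.ω.im) (ψ : Bra N) (v : Ket N) :
    Continuous fun l => ψ (P.opD l v) := by
  induction v using Finsupp.induction_linear with
  | zero => simp only [map_zero]; exact continuous_const
  | add v w hv hw => simp only [map_add]; exact hv.add hw
  | single p z =>
    have : Finsupp.single p z = z • basisKet p.1 p.2 := by simp [basisKet]
    simp only [this, map_smul, opD_basisKet, map_sum, smul_eq_mul]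
    exact continuous_const.mul (continuous_finsetSum _ fun g _ =>
      (P.continuous_monodromyEntry hω _ _ _ _ _).mul continuous_const)

theorem continuous_dCoeff (hω : 0 < P.ω.im) (r : ℤ) (h : Spins N) :
    Continuous fun l => P.dCoeff r h l := by
  have := P.continuous_th hω
  unfold dCoeff
  fun_prop

/-- The zeros lie in a translate of the countable set Γ. This permits division by the theta factor,
the excluded `l` being recovered by continuity. -/
theorem dense_th_sub_ne_zero (hω : 0 < P.ω.im) (μ : ℂ) : Dense {l | P.th (l - μ) ≠ 0} := by
  have hc : ((fun z => z + μ) '' lattice P.ω).Countable := (lattice_countable P.ω).image _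
  refine Dense.mono (fun l hl h0 => ?_) (hc.dense_compl ℂ)
  exact hl ⟨l - μ, theta_eq_zero hω h0, sub_add_cancel _ _⟩

theorem dCoeff_zero (r : ℤ) (l : ℂ) :
    P.dCoeff (r - 1) (fun _ => 0) l = cexp (-(I * P.y * P.η)) ^ N * (∏ n, P.th (l - P.ξ n)) *
      (P.th (P.tVal r (fun _ => 0) - P.η) /
        P.th (P.tVal r (fun _ => 0) + ((N : ℂ) - 1) * P.η)) := by
  have h0 : P.tVal (r - 1) (fun _ : Fin N => 0) = P.tVal r (fun _ => 0) - P.η := by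
    simp only [tVal]
    push_cast
    ring
  have h1 : P.tVal (r - 1) (fun _ : Fin N => 1) =
      P.tVal r (fun _ => 0) + ((N : ℂ) - 1) * P.η := by
    simp only [tVal, spinSum_eq]
    simp
    ring
  rw [dCoeff, h0, h1, ← Complex.exp_nat_mul, spinSum_eq, spinSum_eq]
  simp
  ring_nf

theorem dCoeff_one (ht : ∀ a, P.Regular (P.tEig a)) (r : ℤ) (l : ℂ) :
    P.dCoeff r (fun _ => 1) l = ∏ n, P.wa (l - P.ξ n) := by
  simp [dCoeff, th_tVal_ne_zero ht, wa, sub_add]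

theorem bra_comp_opD (hω : 0 < P.ω.im) (hP : P.Nondegenerate) (ht : ∀ a, P.Regular (P.tEig a))
    (c : ℂ) (r : ℤ) (h : Spins N) (l : ℂ) :
    P.bra c r h ∘ₗ P.opD l = P.dCoeff (r - 1) h l • P.bra c (r - 1) h := by
  induction h using spins_induction_up generalizing l with
  | h0 =>
    refine ket_hom_ext fun g a => ?_
    rw [bra_zero, bra_zero, braRef, braRef, LinearMap.comp_apply, LinearMap.smul_apply,
      LinearMap.smul_apply, LinearMap.smul_apply, opD_basisKet, map_sum, smul_comm]
    congr 1
    simp only [map_smul, basisBra_basisKet, smul_eq_mul, mul_ite, mul_one, mul_zero]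
    have hr : tIndex (r - 1) (fun _ : Fin N => 0) = tIndex r (fun _ : Fin N => 0) + 1 := by
      simp only [tIndex]
      ring
    by_cases ha : a = tIndex r (fun _ : Fin N => 0) + 1
    · subst ha
      simp only [hr, add_sub_cancel_right, and_true, Finset.sum_ite_eq', Finset.mem_univ, if_true]
      by_cases hg : g = fun _ => 0
      · subst hg
        rw [if_pos rfl, monodromyEntry_one_one_up P (ht _), dCoeff_zero, tEig_tIndex]
      · rw [if_neg hg, monodromyEntry_one_one_up_row _ _ _ hg]
    · have ha' : a - 1 ≠ tIndex r (fun _ : Fin N => 0) := fun h => ha (by omega)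
      simp [hr, ha, ha']
  | step h n hn ih =>
    refine ket_hom_ext fun g a => ?_
    have hcont := continuous_opD hω (P.bra c r (Function.update h n 1)) (basisKet g a)
    have hcont' := (continuous_dCoeff hω (r - 1) (Function.update h n 1)).mul
      (continuous_const (y := P.bra c (r - 1) (Function.update h n 1) (basisKet g a)))
    refine congrFun (hcont.ext_on (dense_th_sub_ne_zero hω (P.ξ n)) hcont' fun l hl => ?_) l
    have hl : P.th (l - P.ξ n) ≠ 0 := hl
    have key := congrArg (P.bra c r h) (P.opC_opD_left hω ht l (P.ξ n) g a)
    have ih' : ∀ l v, P.bra c r h (P.opD l v) = P.dCoeff (r - 1) h l * P.bra c (r - 1) h v :=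
      fun l v => LinearMap.congr_fun (ih l) v
    -- The unwanted exchange term carries this coefficient; its factor at site `n` is θ(0) because
    -- `h n = 0`.
    have h0 : P.dCoeff (r - 1) h (P.ξ n) = 0 :=
      (dCoeff_eq_zero_iff ht _ _ _).2 ⟨n, by simp [hn, th_zero]⟩
    simp only [map_smul, map_add, smul_eq_mul, ih', h0, zero_mul, mul_zero, zero_add] at key
    have hR : ∀ b, P.R (l - P.ξ n) (P.tEig b) (1, 0) (1, 0) ≠ 0 := fun b => by
      rw [R_10_10, wb_neg]
      exact mul_ne_zero (Complex.exp_ne_zero _)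
        (div_ne_zero (mul_ne_zero hl (ht b).sub_ne) (ht b).ne)
    simp only [bra_update hω hP ht c _ hn, LinearMap.comp_apply, LinearMap.smul_apply, map_smul,
      smul_eq_mul, Pi.mul_apply]
    refine mul_left_cancel₀ (hR a) ?_
    -- Off the support both sides vanish; on it, `t(a)` is the value at which the coefficients
    -- satisfy their recursion.
    by_cases hb : P.bra c (r - 1) h (P.opC (P.ξ n) (basisKet g a)) = 0
    · rw [hb] at key ⊢
      linear_combination -(P.fd (P.ξ n - P.η))⁻¹ * key
    · have hs : a = tIndex (r - 1) (Function.update h n 1) := by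
        refine (bra_support hω hP ht c (r - 1) (Function.update h n 1) g a ?_).1
        rw [bra_update hω hP ht c _ hn, LinearMap.comp_apply, LinearMap.smul_apply, map_smul]
        exact smul_ne_zero (inv_ne_zero (fd_sub_ne_zero hP n)) hb
      have hd := dCoeff_update_left ht (r - 1) l hn
      rw [← tEig_tIndex, ← hs] at hd
      linear_combination -(P.fd (P.ξ n - P.η))⁻¹ * key + (P.fd (P.ξ n - P.η))⁻¹ *
        P.bra c (r - 1) h (P.opC (P.ξ n) (basisKet g a)) * hd

theorem eqOn_weightSpace {a : ℤ} {w : ℕ} {f g : Module.End ℂ (Ket N)}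
    (hfg : ∀ h : Spins N, f (basisKet h a) = g (basisKet h a)) {v : Ket N}
    (hv : v ∈ weightSpace N a w) : f v = g v := by
  refine LinearMap.eqOn_span (f := f) (g := g) ?_ hv
  rintro _ ⟨h, -, rfl⟩
  exact hfg h

theorem opD_ket (hω : 0 < P.ω.im) (hP : P.Nondegenerate) (ht : ∀ a, P.Regular (P.tEig a))
    (c : ℂ) (r : ℤ) (h : Spins N) (l : ℂ) :
    P.opD l (P.ket c r h) = P.dCoeff (r + 1) h l • P.ket c (r + 1) h := by
  induction h using spins_induction_down generalizing l with
  | h1 =>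
    have hr : tIndex (r + 1) (fun _ : Fin N => 1) = tIndex r (fun _ : Fin N => 1) - 1 := by
      simp only [tIndex]
      ring
    rw [ket_one, ket_one, ketRef, ketRef, map_smul, smul_comm, opD_basisKet, hr, dCoeff_one ht,
      Finset.sum_eq_single (fun _ => 1), monodromyEntry_one_one_down]
    · intro g _ hg
      rw [monodromyEntry_one_one_down_col _ _ _ hg, zero_smul]
    · simp
  | step h n hn ih =>
    refine Finsupp.ext fun p => ?_
    have hcont := continuous_opD hω (Finsupp.lapply p) (P.ket c r (Function.update h n 0))
    have hcont' := (continuous_dCoeff hω (r + 1) (Function.update h n 0)).mul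
      (continuous_const (y := P.ket c (r + 1) (Function.update h n 0) p))
    refine congrFun (hcont.ext_on (dense_th_sub_ne_zero hω (P.ξ n - P.η)) hcont' fun l hl => ?_) l
    refine DFunLike.congr_fun (?_ : P.opD l (P.ket c r (Function.update h n 0)) =
      P.dCoeff (r + 1) (Function.update h n 0) l • P.ket c (r + 1) (Function.update h n 0)) p
    have hl : P.th (P.ξ n - P.η - l) ≠ 0 := by
      rw [← neg_sub, P.th_neg]
      exact neg_ne_zero.2 hl
    set a := tIndex r h with ha
    set t := P.tEig a with hta
    -- The ket has a single value of `a`, so the exchange relation applies to it with a scalar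
    -- dynamical parameter.
    have key := eqOn_weightSpace
      (f := P.wa (P.ξ n - P.η - l) • (P.opC (P.ξ n - P.η) * P.opD l))
      (g := P.R (P.ξ n - P.η - l) t (0, 1) (0, 1) • (P.opD l * P.opC (P.ξ n - P.η)) +
        P.R (P.ξ n - P.η - l) t (1, 0) (0, 1) • (P.opC l * P.opD (P.ξ n - P.η)))
      (fun g => P.opC_opD_right hω ht (P.ξ n - P.η) l g a) (ket_mem_weightSpace hω hP ht c r h)
    have h0 : P.dCoeff (r + 1) h (P.ξ n - P.η) = 0 :=
      (dCoeff_eq_zero_iff ht _ _ _).2 ⟨n, by simp [hn, th_zero]⟩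
    simp only [LinearMap.smul_apply, LinearMap.add_apply, Module.End.mul_apply, ih, h0, zero_smul,
      map_zero, smul_zero, add_zero, map_smul, smul_smul] at key
    have hR : P.R (P.ξ n - P.η - l) t (0, 1) (0, 1) ≠ 0 := by
      rw [R_01_01, wb]
      exact mul_ne_zero (Complex.exp_ne_zero _)
        (div_ne_zero (mul_ne_zero hl (ht a).add_ne) (ht a).ne)
    have hu := update_zero_update_one hn
    -- Raising `r` by one compensates for the loss of one down spin.
    have htv : t = P.tVal (r + 1) (Function.update h n 0) := by
      rw [← tEig_tIndex, hta, ha]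
      congr 1
      have := sum_update_one (h := Function.update h n 0) (n := n) (by simp)
      rw [hu] at this
      rw [tIndex_eq, tIndex_eq, this]
      push_cast
      ring
    have hd := dCoeff_update_right (h := Function.update h n 0) (n := n) ht (r + 1) l (by simp)
    rw [hu, ← htv] at hd
    rw [hd, mul_smul] at key
    have key' := smul_right_injective _ hR key
    rw [ket_update hω hP ht c _ hn, ket_update hω hP ht c _ hn, map_smul, ← key', smul_comm]

end Params

/-! ### Nonvanishing and linear independence of the states. -/

namespace Params

theorem update_domainWall {N : ℕ} (s s' : Fin 2) (n : Fin N) :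
    Function.update (domainWall s s' (n + 1)) n s' = domainWall s s' n := by
  funext k
  by_cases hk : k = n
  · subst hk; simp [domainWall]
  · have : (k : ℕ) < n + 1 ↔ (k : ℕ) < n := by
      have : (k : ℕ) ≠ n := fun h => hk (Fin.ext h)
      omega
    simp [domainWall, hk, this]

theorem domainWall_self {N : ℕ} (s s' : Fin 2) :
    (domainWall s s' N : Spins N) = fun _ => s := by
  funext k
  simp [domainWall]

theorem domainWall_apply {N : ℕ} (s s' : Fin 2) (n : Fin N) :
    (domainWall s s' (n + 1) : Spins N) n = s := by
  simp [domainWall]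

variable {N : ℕ} {P : Params N}

/-- Adding `𝒞(ξ_N)`, then `𝒞(ξ_{N-1})`, and so on moves the wall one site at a time, and
`monodromyEntry_one_zero_row` leaves a single covector at each step. -/
theorem bra_domainWall (hω : 0 < P.ω.im) (hP : P.Nondegenerate)
    (ht : ∀ a, P.Regular (P.tEig a)) {c : ℂ} (hc : c ≠ 0) (r : ℤ) {m : ℕ} (hm : m ≤ N) :
    ∃ κ : ℂ, κ ≠ 0 ∧ ∃ a : ℤ,
      P.bra c r (domainWall 0 1 m) = κ • basisBra (domainWall 0 1 m) a := by
  induction hm using Nat.decreasingInduction with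
  | self => exact ⟨c⁻¹, inv_ne_zero hc, _, by rw [domainWall_self, bra_zero, braRef]⟩
  | of_succ m hm ih =>
    obtain ⟨κ, hκ, a, h⟩ := ih
    have hrow := P.monodromyEntry_one_zero_row hP (ht a) ⟨m, hm⟩
    refine ⟨_, mul_ne_zero (mul_ne_zero hκ (inv_ne_zero (fd_sub_ne_zero hP ⟨m, hm⟩)))
      ((hrow (domainWall 0 1 m)).2 rfl), a - 1, ?_⟩
    refine ket_hom_ext fun g b => ?_
    have hu := update_domainWall 0 1 (⟨m, hm⟩ : Fin N)
    have hw := domainWall_apply 0 1 (⟨m, hm⟩ : Fin N)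
    simp only at hu hw hrow
    rw [← hu, bra_update hω hP ht c r hw, hu, h]
    simp only [LinearMap.comp_apply, LinearMap.smul_apply, map_smul, opC_basisKet, map_sum,
      basisBra_basisKet, smul_eq_mul]
    by_cases hb : b + 1 = a
    · have hb' : b = a - 1 := by omega
      subst hb'
      by_cases hg : g = domainWall 0 1 m
      · subst hg
        simp
        ring
      · have := not_not.1 (mt (hrow g).1 hg)
        simp [hg, this]
    · have hb' : b ≠ a - 1 := by omega
      simp [hb, hb']

theorem ket_domainWall (hω : 0 < P.ω.im) (hP : P.Nondegenerate)
    (ht : ∀ a, P.Regular (P.tEig a)) {c : ℂ} (hc : c ≠ 0) (r : ℤ) {m : ℕ} (hm : m ≤ N) :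
    ∃ κ : ℂ, κ ≠ 0 ∧ ∃ a : ℤ,
      P.ket c r (domainWall 1 0 m) = κ • basisKet (domainWall 1 0 m) a := by
  induction hm using Nat.decreasingInduction with
  | self => exact ⟨c⁻¹, inv_ne_zero hc, _, by rw [domainWall_self, ket_one, ketRef]⟩
  | of_succ m hm ih =>
    obtain ⟨κ, hκ, a, h⟩ := ih
    have hcol := P.monodromyEntry_one_zero_col hP (ht (a + 1)) ⟨m, hm⟩
    refine ⟨_, mul_ne_zero (mul_ne_zero (inv_ne_zero (fd_sub_ne_zero hP ⟨m, hm⟩)) hκ)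
      ((hcol (domainWall 1 0 m)).2 rfl), a + 1, ?_⟩
    have hu := update_domainWall 1 0 (⟨m, hm⟩ : Fin N)
    have hw := domainWall_apply 1 0 (⟨m, hm⟩ : Fin N)
    simp only at hu hw hcol
    rw [← hu, ket_update hω hP ht c r hw, hu, h, map_smul, opC_basisKet,
      Finset.sum_eq_single (domainWall 1 0 m), smul_smul, smul_smul]
    · intro g _ hg
      rw [not_not.1 (mt (hcol g).1 hg), zero_smul]
    · simp

/-- Further factors `𝒞` carry any of these states to the one with all spins flipped, so that one
alone needs to be nonzero. -/
theorem bra_ne_zero (hω : 0 < P.ω.im) (hP : P.Nondegenerate)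
    (ht : ∀ a, P.Regular (P.tEig a)) {c : ℂ} (hc : c ≠ 0) (r : ℤ) (h : Spins N) :
    P.bra c r h ≠ 0 := by
  induction h using spins_induction_down with
  | h1 =>
    obtain ⟨κ, hκ, a, h⟩ := bra_domainWall hω hP ht hc r (Nat.zero_le N)
    rw [domainWall_zero] at h
    intro h0
    have := LinearMap.congr_fun (h.symm.trans h0) (basisKet (fun _ => 1) a)
    simp [basisBra_basisKet, hκ] at this
  | step h n hn ih =>
    intro h0
    refine ih ?_
    rw [← update_zero_update_one hn, bra_update hω hP ht c r (by simp), h0, LinearMap.zero_comp]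

theorem ket_ne_zero (hω : 0 < P.ω.im) (hP : P.Nondegenerate)
    (ht : ∀ a, P.Regular (P.tEig a)) {c : ℂ} (hc : c ≠ 0) (r : ℤ) (h : Spins N) :
    P.ket c r h ≠ 0 := by
  induction h using spins_induction_up with
  | h0 =>
    obtain ⟨κ, hκ, a, h⟩ := ket_domainWall hω hP ht hc r (Nat.zero_le N)
    rw [domainWall_zero] at h
    rw [h]
    simp [basisKet, hκ]
  | step h n hn ih =>
    intro h0
    refine ih ?_
    rw [← update_one_update_zero hn, ket_update hω hP ht c r (by simp), h0, map_zero, smul_zero]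

/-- A suitable product of the `X l` annihilates all states but one. The family `X` and the shift `δ`
are abstract so as to cover kets (`δ = 1`) and bras (`δ = -1`). -/
theorem linearIndependent_of_ladder (hP : P.Nondegenerate) (ht : ∀ a, P.Regular (P.tEig a))
    {V : Type*} [AddCommGroup V] [Module ℂ V] (X : ℂ → Module.End ℂ V) (v : ℤ → Spins N → V)
    (δ : ℤ) (hX : ∀ r h l, X l (v r h) = P.dCoeff (r + δ) h l • v (r + δ) h)
    (hv : ∀ r h, v r h ≠ 0) (r : ℤ) : LinearIndependent ℂ (v r) := by
  have hprod : ∀ (L : List ℂ) (r : ℤ) (h : Spins N), ∃ K : ℂ,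
      (L.map X).prod (v r h) = K • v (r + L.length * δ) h ∧
      (K = 0 ↔ ∃ l ∈ L, ∃ n, P.th (l - (P.ξ n - P.η * ((h n : ℕ) : ℂ))) = 0) := by
    intro L
    induction L with
    | nil => exact fun r h => ⟨1, by simp⟩
    | cons l L ih =>
      intro r h
      obtain ⟨K, hK, hK'⟩ := ih r h
      refine ⟨K * P.dCoeff (r + L.length * δ + δ) h l, ?_, ?_⟩
      · rw [List.map_cons, List.prod_cons, Module.End.mul_apply, hK, map_smul, hX, smul_smul,
          List.length_cons]
        congr 2
        push_cast
        ring
      · rw [mul_eq_zero, hK', dCoeff_eq_zero_iff ht]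
        simp only [List.mem_cons, exists_eq_or_imp]
        exact or_comm
  rw [Fintype.linearIndependent_iff]
  intro α hα h
  -- These are the zeros belonging to the flipped labels `1 - h n`, so any `g` that differs from `h`
  -- somewhere is killed.
  set L : List ℂ := List.ofFn fun n => P.ξ n - P.η * (1 - ((h n : ℕ) : ℂ)) with hL
  choose K hK hK' using fun g => hprod L r g
  have h1 : ∀ g, g ≠ h → K g = 0 := by
    intro g hg
    obtain ⟨n, hn⟩ := Function.ne_iff.1 hg
    refine (hK' g).2 ⟨_, (List.mem_ofFn' _ _).2 ⟨n, rfl⟩, n, ?_⟩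
    have : ((g n : ℕ) : ℂ) = 1 - ((h n : ℕ) : ℂ) := by
      have : (g n : ℕ) + h n = 1 := by omega
      rw [eq_sub_iff_add_eq]
      exact_mod_cast this
    rw [this, sub_self, th_zero]
  have h2 : K h ≠ 0 := by
    rw [Ne, hK' h]
    rintro ⟨l, hl, n, h0⟩
    obtain ⟨m, rfl⟩ := (List.mem_ofFn' _ _).1 hl
    revert h0
    change P.th (P.ξ m - P.η * (1 - ((h m : ℕ) : ℂ)) - (P.ξ n - P.η * ((h n : ℕ) : ℂ))) ≠ 0
    -- The argument is `±η` when `m = n`, and otherwise `ξ_m - ξ_n + εη` with `ε` in {-1, 0, 1}.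
    rcases eq_or_ne m n with rfl | hmn
    · rcases eq_zero_or_eq_one (h m) with hm | hm
      · convert neg_ne_zero.2 hP.th_η using 1
        rw [← P.th_neg, hm]
        congr 1
        simp
      · convert hP.th_η using 2
        rw [hm]
        simp
    · rcases eq_zero_or_eq_one (h m) with hm | hm <;>
        rcases eq_zero_or_eq_one (h n) with hn | hn <;> rw [hm, hn]
      · convert hP.th_sub_sub m n hmn using 2
        simp
        ring
      · convert hP.th_sub m n hmn using 2
        simp
      · convert hP.th_sub m n hmn using 2
        simp
      · convert hP.th_sub_add m n hmn using 2
        simp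
        ring
  have := congrArg (L.map X).prod hα
  simp only [map_sum, map_smul, hK, map_zero] at this
  rw [Finset.sum_eq_single h (fun g _ hg => by rw [h1 g hg, zero_smul, smul_zero]) (by simp),
    smul_smul] at this
  exact (mul_eq_zero.1 ((smul_eq_zero.1 this).resolve_right (hv _ _))).resolve_right h2

/-! ### Eigenspaces of `S_τ`. -/

theorem Stau_basisKet (h : Spins N) (a : ℤ) :
    P.Stau (basisKet h a) = (P.η * spinSum h + 2 * P.tEig a) • basisKet h a := by
  simp only [Stau, LinearMap.add_apply, LinearMap.smul_apply, spinOp_basisKet, tau_basisKet,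
    smul_smul, add_smul]

/-- The two eigenvalues differ by an integer multiple of `2η`, and `η ≠ 0`; each spin configuration
thus meets the eigenspace for exactly one `a`. -/
theorem Stau_eigenvalue_eq_iff (hη : ∀ k : ℤ, k ≠ 0 → (k : ℂ) * P.η ∉ lattice P.ω) (r : ℤ)
    (h : Spins N) (a : ℤ) :
    P.η * spinSum h + 2 * P.tEig a = P.StauEig r ↔ a = tIndex r h := by
  have key : P.η * spinSum h + 2 * P.tEig a - P.StauEig r =
      2 * (((tIndex r h - a : ℤ) : ℂ) * P.η) := by
    simp only [spinSum_eq, tEig, StauEig, t0, tIndex]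
    push_cast
    ring
  rw [← sub_eq_zero, key]
  constructor
  · intro h0
    by_contra hne
    refine hη (tIndex r h - a) (fun h => hne (by omega)) ⟨0, 0, ?_⟩
    simpa using h0
  · rintro rfl
    simp

theorem ketEigenspace_le (hη : ∀ k : ℤ, k ≠ 0 → (k : ℂ) * P.η ∉ lattice P.ω) (r : ℤ) :
    P.ketEigenspace r ≤ Submodule.span ℂ (Set.range fun g : Spins N => basisKet g (tIndex r g)) := by
  intro v hv
  have hv := Module.End.mem_eigenspace_iff.1 hv
  have hcoord : ∀ (v : Ket N) g a,
      P.Stau v (g, a) = (P.η * spinSum g + 2 * P.tEig a) * v (g, a) := by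
    intro v g a
    induction v using Finsupp.induction_linear with
    | zero => simp
    | add v w hv hw => simp [hv, hw, mul_add]
    | single p z =>
      have : Finsupp.single p z = z • basisKet p.1 p.2 := by simp [basisKet]
      rw [this, map_smul, Stau_basisKet]
      by_cases hp : p = (g, a)
      · subst hp
        simp
        ring
      · have : basisKet p.1 p.2 (g, a) = 0 := Finsupp.single_eq_of_ne' hp
        simp [this]
  have hzero : ∀ g a, v (g, a) ≠ 0 → a = tIndex r g := by
    intro g a hne
    refine (P.Stau_eigenvalue_eq_iff hη r g a).1 (mul_right_cancel₀ hne ?_)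
    rw [← hcoord, hv]
    rfl
  rw [← Finsupp.sum_single v]
  refine Submodule.sum_mem _ fun p hp => ?_
  have : Finsupp.single p (v p) = v p • basisKet p.1 (tIndex r p.1) := by
    rw [← hzero p.1 p.2 (Finsupp.mem_support_iff.1 hp)]
    simp [basisKet]
  rw [this]
  exact Submodule.smul_mem _ _ (Submodule.subset_span ⟨p.1, rfl⟩)

theorem braEigenspace_le (hη : ∀ k : ℤ, k ≠ 0 → (k : ℂ) * P.η ∉ lattice P.ω) (r : ℤ) :
    P.braEigenspace r ≤ Submodule.span ℂ (Set.range fun g : Spins N => basisBra g (tIndex r g)) := by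
  intro ψ hψ
  have hψ := Module.End.mem_eigenspace_iff.1 hψ.2
  have hzero : ∀ g a, ψ (basisKet g a) ≠ 0 → a = tIndex r g := by
    intro g a hne
    refine (P.Stau_eigenvalue_eq_iff hη r g a).1 (mul_right_cancel₀ hne ?_)
    have := LinearMap.congr_fun hψ (basisKet g a)
    rwa [LinearMap.dualMap_apply, Stau_basisKet, map_smul] at this
  have : ψ = ∑ g, ψ (basisKet g (tIndex r g)) • basisBra g (tIndex r g) := by
    refine ket_hom_ext fun g a => ?_
    simp only [LinearMap.sum_apply, LinearMap.smul_apply, basisBra_basisKet, smul_eq_mul]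
    rw [Finset.sum_eq_single g (fun h _ hne => by simp [hne.symm]) (by simp)]
    by_cases ha : a = tIndex r g
    · simp [ha]
    · simp [ha, not_not.1 (mt (hzero g a) ha)]
  rw [this]
  exact Submodule.sum_mem _ fun g _ => Submodule.smul_mem _ _ (Submodule.subset_span ⟨g, rfl⟩)

theorem tIndex_congr {g h : Spins N} (hs : ∑ k, (g k : ℕ) = ∑ k, (h k : ℕ)) (r : ℤ) :
    tIndex r g = tIndex r h := by
  rw [tIndex_eq, tIndex_eq, hs]

theorem bra_mem (hη : ∀ k : ℤ, k ≠ 0 → (k : ℂ) * P.η ∉ lattice P.ω)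
    (hω : 0 < P.ω.im) (hP : P.Nondegenerate)
    (ht : ∀ a, P.Regular (P.tEig a)) (c : ℂ) (r : ℤ) (h : Spins N) :
    P.bra c r h ∈ P.braEigenspace r := by
  have hsupp := bra_support hω hP ht c r h
  constructor
  · have : P.bra c r h = ∑ g, P.bra c r h (basisKet g (tIndex r h)) • basisBra g (tIndex r h) := by
      refine ket_hom_ext fun g a => ?_
      simp only [LinearMap.sum_apply, LinearMap.smul_apply, basisBra_basisKet, smul_eq_mul]
      rw [Finset.sum_eq_single g (fun h _ hne => by simp [hne.symm]) (by simp)]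
      by_cases ha : a = tIndex r h
      · simp [ha]
      · simp [ha, not_not.1 (mt (fun hne => (hsupp g a hne).1) ha)]
    rw [this]
    exact Submodule.sum_mem _ fun g _ =>
      Submodule.smul_mem _ _ (Submodule.subset_span ⟨(g, tIndex r h), rfl⟩)
  · refine Module.End.mem_eigenspace_iff.2 (ket_hom_ext fun g a => ?_)
    rw [LinearMap.dualMap_apply, Stau_basisKet, map_smul, LinearMap.smul_apply]
    by_cases h0 : P.bra c r h (basisKet g a) = 0
    · rw [h0, smul_zero, smul_zero]
    · obtain ⟨h₁, h₂⟩ := hsupp g a h0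
      rw [(P.Stau_eigenvalue_eq_iff hη r g a).2 (h₁.trans (tIndex_congr h₂ r).symm)]

theorem ket_mem (hη : ∀ k : ℤ, k ≠ 0 → (k : ℂ) * P.η ∉ lattice P.ω)
    (hω : 0 < P.ω.im) (hP : P.Nondegenerate)
    (ht : ∀ a, P.Regular (P.tEig a)) (c : ℂ) (r : ℤ) (h : Spins N) :
    P.ket c r h ∈ P.ketEigenspace r := by
  have hle : weightSpace N (tIndex r h) (∑ k, (h k : ℕ)) ≤ P.ketEigenspace r := by
    refine Submodule.span_le.2 ?_
    rintro _ ⟨g, hg, rfl⟩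
    refine Module.End.mem_eigenspace_iff.2 ?_
    rw [Stau_basisKet, (P.Stau_eigenvalue_eq_iff hη r g _).2 (tIndex_congr hg r).symm]
  exact hle (ket_mem_weightSpace hω hP ht c r h)

/-! ### Genericity, dimension count and conclusion. -/

theorem nondegenerate (hω : 0 < P.ω.im)
    (hη : ∀ k : ℤ, k ≠ 0 → (k : ℂ) * P.η ∉ lattice P.ω)
    (hξ : ∀ ε : ℤ, ε = -1 ∨ ε = 0 ∨ ε = 1 →
      ∀ a b : Fin N, a ≠ b → P.ξ a - P.ξ b + (ε : ℂ) * P.η ∉ lattice P.ω) :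
    P.Nondegenerate where
  th_η h := hη 1 one_ne_zero (by simpa using theta_eq_zero hω h)
  th_sub a b hab h := hξ 0 (by simp) a b hab (by simpa using theta_eq_zero hω h)
  th_sub_add a b hab h := hξ 1 (by simp) a b hab (by simpa using theta_eq_zero hω h)
  th_sub_sub a b hab h := hξ (-1) (by simp) a b hab
    (by simpa [sub_eq_add_neg] using theta_eq_zero hω h)

/-- Twice a zero puts `(2(k - a) - N)η` in Γ. Genericity makes this integer vanish, so `N` is even;
independence of 1 and `ω` over ℝ then makes `x` and `y` even, hence zero, which is excluded. -/
theorem regular_tEig (hω : 0 < P.ω.im)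
    (hη : ∀ k : ℤ, k ≠ 0 → (k : ℂ) * P.η ∉ lattice P.ω)
    (hx : P.x = 0 ∨ P.x = 1) (hy : P.y = 0 ∨ P.y = 1)
    (hxy : Even N → ¬ (P.x = 0 ∧ P.y = 0)) (a : ℤ) : P.Regular (P.tEig a) := by
  intro k h0
  obtain ⟨m, n, h⟩ := theta_eq_zero hω h0
  have h2 : ((2 * (k - a) - N : ℤ) : ℂ) * P.η =
      Real.pi * ((2 * m - P.x : ℤ) : ℂ) + Real.pi * P.ω * ((2 * n - P.y : ℤ) : ℂ) := by
    simp only [tEig, t0] at h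
    push_cast
    linear_combination 2 * h
  by_cases hN : 2 * (k - a) - (N : ℤ) = 0
  · rw [hN, Int.cast_zero, zero_mul] at h2
    have hp : (Real.pi : ℂ) ≠ 0 := by exact_mod_cast Real.pi_ne_zero
    have h3 : ((2 * m - P.x : ℤ) : ℂ) + P.ω * ((2 * n - P.y : ℤ) : ℂ) = 0 := by
      refine mul_left_cancel₀ hp ?_
      linear_combination -h2
    have him := congrArg Complex.im h3
    have hre := congrArg Complex.re h3
    simp only [Complex.add_im, Complex.add_re, Complex.mul_im, Complex.mul_re, Complex.intCast_im,
      Complex.intCast_re, Complex.zero_im, Complex.zero_re, mul_zero, zero_add, sub_zero] at him hre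
    have hn := (mul_eq_zero.1 him).resolve_left hω.ne'
    rw [hn, mul_zero, add_zero] at hre
    have hn' : 2 * n - (P.y : ℤ) = 0 := by exact_mod_cast hn
    have hm' : 2 * m - (P.x : ℤ) = 0 := by exact_mod_cast hre
    refine hxy ⟨(k - a).toNat, ?_⟩ ⟨?_, ?_⟩ <;> omega
  · exact hη _ hN ⟨_, _, h2⟩

end Params

theorem exists_basis_of_le_span {N : ℕ} {V : Type*} [AddCommGroup V] [Module ℂ V]
    {W : Submodule ℂ V} {b v : Spins N → V} (hW : W ≤ Submodule.span ℂ (Set.range b))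
    (hv : ∀ h, v h ∈ W) (hli : LinearIndependent ℂ v) :
    Module.finrank ℂ W = 2 ^ N ∧
      ∃ B : Module.Basis (Spins N) ℂ W, ∀ h, (B h : V) = v h := by
  have hcard : Fintype.card (Spins N) = 2 ^ N := by simp
  have : FiniteDimensional ℂ (Submodule.span ℂ (Set.range b)) :=
    FiniteDimensional.span_of_finite ℂ (Set.finite_range b)
  have : FiniteDimensional ℂ W := Submodule.finiteDimensional_of_le hW
  have hle : Module.finrank ℂ W ≤ 2 ^ N :=
    (Submodule.finrank_mono hW).trans ((finrank_range_le_card b).trans hcard.le)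
  have hli' : LinearIndependent ℂ fun h => (⟨v h, hv h⟩ : W) :=
    LinearIndependent.of_comp W.subtype hli
  have hge := hli'.fintype_card_le_finrank
  have heq : Fintype.card (Spins N) = Module.finrank ℂ W := le_antisymm hge (hcard ▸ hle)
  exact ⟨heq.symm.trans hcard, basisOfLinearIndependentOfCardEqFinrank hli' heq, fun h => by simp⟩

end SOS

end

theorem mainTheorem7 (N : ℕ) (P : SOS.Params N)
    (hω : 0 < P.ω.im)
    (hη : ∀ k : ℤ, k ≠ 0 → (k : ℂ) * P.η ∉ SOS.lattice P.ω)
    (hx : P.x = 0 ∨ P.x = 1) (hy : P.y = 0 ∨ P.y = 1)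
    (hxy : Even N → ¬ (P.x = 0 ∧ P.y = 0))
    (hξ : ∀ ε : ℤ, ε = -1 ∨ ε = 0 ∨ ε = 1 →
      ∀ a b : Fin N, a ≠ b → P.ξ a - P.ξ b + (ε : ℂ) * P.η ∉ SOS.lattice P.ω)
    (c : ℂ) (hc : c ≠ 0) :
    (∀ r : ℤ,
      Module.finrank ℂ (P.braEigenspace r) = 2 ^ N ∧
      ∃ B : Module.Basis (SOS.Spins N) ℂ (P.braEigenspace r),
        ∀ h, (B h : SOS.Bra N) = P.bra c r h) ∧
    (∀ r : ℤ,
      Module.finrank ℂ (P.ketEigenspace r) = 2 ^ N ∧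
      ∃ B : Module.Basis (SOS.Spins N) ℂ (P.ketEigenspace r),
        ∀ h, (B h : SOS.Ket N) = P.ket c r h) ∧
    (∀ (r : ℤ) (h : SOS.Spins N) (l : ℂ),
      P.bra c r h ∘ₗ P.opD l = P.dCoeff (r - 1) h l • P.bra c (r - 1) h) ∧
    (∀ (r : ℤ) (h : SOS.Spins N) (l : ℂ),
      P.opD l (P.ket c r h) = P.dCoeff (r + 1) h l • P.ket c (r + 1) h) := by
  have hP := P.nondegenerate hω hη hξ
  have ht := P.regular_tEig hω hη hx hy hxy
  have hD := P.bra_comp_opD hω hP ht c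
  have hD' := P.opD_ket hω hP ht c
  refine ⟨fun r => ?_, fun r => ?_, hD, hD'⟩
  -- Operators act on bras by transposition, and there `𝒟` lowers `r`.
  · exact SOS.exists_basis_of_le_span (P.braEigenspace_le hη r) (P.bra_mem hη hω hP ht c r)
      (P.linearIndependent_of_ladder hP ht (fun l => (P.opD l).dualMap) (P.bra c) (-1) hD
        (P.bra_ne_zero hω hP ht hc) r)
  · exact SOS.exists_basis_of_le_span (P.ketEigenspace_le hη r) (P.ket_mem hη hω hP ht c r)
      (P.linearIndependent_of_ladder hP ht P.opD (P.ket c) 1 hD'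
        (P.ket_ne_zero hω hP ht hc) r)
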